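/- Let $\mathcal{O}$ be a Dedekind domain that is not a field, with $\mathcal{O}/\mathfrak{a}$ finite for every nonzero ideal $\mathfrak{a}$; write $N(\mathfrak{a})=|\mathcal{O}/\mathfrak{a}|$ and let $K$ be the fraction field of $\mathcal{O}$. Let $\mathcal{A}=(c_1,\dots,c_n)$ be a finite family of nonzero column vectors in $\mathcal{O}^\ell$. *Quasi-polynomial side.* For a nonzero ideal $\mathfrak{a}$ let $$\chi^{\mathrm{quasi}}_{\mathcal{A}}(\mathfrak{a})=\bigl|\{y\in(\mathcal{O}/\mathfrak{a})^\ell : y c_j\neq 0 \text{ for all } j\}\bigr|.$$ For $J\subseteq[n]$ let $\phi_J:\mathcal{O}^\ell\to\mathcal{O}^{J}$, $x\mapsto(xc_j)_{j\in J}$, let $r(J)$ be the rank of its image, and let $\mathfrak{d}_{J,1}\mid\cdots\mid\mathfrak{d}_{J,r(J)}$ be the nonzero ideals with $\operatorname{tors}(\operatorname{coker}\phi_J)\cong\bigoplus_{i=1}^{r(J)}\mathcal{O}/\mathfrak{d}_{J,i}$. Put $$\rho_{\mathcal{A}}=\operatorname{lcm}\{\mathfrak{d}_{J,r(J)} : \varnothing\neq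 J\subseteq[n]\},\qquad m(J,\kappa)=\prod_{i=1}^{r(J)}N(\kappa+\mathfrak{d}_{J,i}),\qquad f^{\kappa}_{\mathcal{A}}(t)=\sum_{J\subseteq[n]}(-1)^{|J|}m(J,\kappa)\,t^{\ell-r(J)}.$$ A polynomial $g\in\mathbb{Z}[t]$ is a *$\kappa$-constituent* of $\chi^{\mathrm{quasi}}_{\mathcal{A}}$ (associated with $\rho_{\mathcal{A}}$) if $\chi^{\mathrm{quasi}}_{\mathcal{A}}(\mathfrak{a})=g(N(\mathfrak{a}))$ for every nonzero ideal $\mathfrak{a}$ with $\mathfrak{a}+\rho_{\mathcal{A}}=\kappa$. *Torsion arrangement side.* Let $\pi:K^\ell\to(K/\mathcal{O})^\ell$ be the projection, $H_j=\{x\in K^\ell : xc_j=0\}$, $T_j=\{\pi(x) : x\in K^\ell,\ xc_j\in\mathcal{O}\}$, $H_J=\bigcap_{j\in J}H_j$ and $T_J=\bigcap_{j\in J}T_j$, with $H_\varnothing=K^\ell$ and $T_\varnothing=(K/\mathcal{O})^\ell$. The poset of layers $L(\mathcal{A}(K/\mathcal{O}))$ is the finite set of all cosets $z+\pi(H_J)$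 with $J\subseteq[n]$ and $z\in T_J$, ordered by reverse inclusion, with Möbius function $\mu$. For a layer $Z$ let $H_Z$ be the unique subspace among the $H_J$ with $Z=z+\pi(H_Z)$ for all $z\in Z$, and let $\dim Z=\dim_K H_Z$; $Z$ is *$\kappa$-torsion* if $aZ\subseteq\pi(H_Z)$ for all $a\in\kappa$. Put $$\chi^{\kappa}_{\mathcal{A}(K/\mathcal{O})}(t)=\sum_{Z\ \kappa\text{-torsion}}\mu(T_\varnothing,Z)\,t^{\dim Z},\qquad \chi_{\mathcal{A}(K/\mathcal{O})}(t)=\sum_{Z\in L(\mathcal{A}(K/\mathcal{O}))}\mu(T_\varnothing,Z)\,t^{\dim Z}.$$ **Theorem.** The ideals $\mathfrak{d}_{J,i}$ exist for every $J\subseteq[n]$. For every ideal $\kappa\mid\rho_{\mathcal{A}}$, $$f^{\kappa}_{\mathcal{A}}(t)=\chi^{\kappa}_{\mathcal{A}(K/\mathcal{O})}(t),$$ and this polynomial is a $\kappa$-constituent of $\chi^{\mathrm{quasi}}_{\mathcal{A}}$ associated with $\rho_{\mathcal{A}}$; it is the only one whenever there are infinitely many nonzero ideals $\mathfrak{a}$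 with $\mathfrak{a}+\rho_{\mathcal{A}}=\kappa$. Moreover $\chi^{\rho_{\mathcal{A}}}_{\mathcal{A}(K/\mathcal{O})}(t)=\chi_{\mathcal{A}(K/\mathcal{O})}(t)$. -/

import Mathlib

/-!
# Arrangements over Dedekind domains with finite quotients

An arrangement is a finite family `c : Fin n → Fin ℓ → O` of vectors `c j ∈ O ^ ℓ`; a subset
`J ⊆ [n]` is a `Finset (Fin n)`, and `K` is the fraction field of `O`.
-/

namespace TorsionArrangement

noncomputable section

/-! ## Characteristic quasi-polynomials and constituents -/

section Quasi

variable {O : Type*} [CommRing O]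

/-- The absolute idealNorm `N(a) = |O / a|`. -/
def idealNorm (a : Ideal O) : ℕ := Nat.card (O ⧸ a)

/-- `g` is a `κ`-constituent, associated with `ρ`, of the function `φ` on nonzero ideals: every
nonzero ideal `a` with `a + ρ = κ` has `φ(a) = g(N(a))`. -/
def IsConstituent (φ : Ideal O → ℤ) (ρ κ : Ideal O) (g : Polynomial ℤ) : Prop :=
  ∀ a : Ideal O, a ≠ ⊥ → a ⊔ ρ = κ → φ a = g.eval (idealNorm a : ℤ)

variable {n ℓ : ℕ} (c : Fin n → Fin ℓ → O)

/-- The hyperplane `H_{j,a} = {[x] : x c_j ≡ 0 mod a}` in `(O / a) ^ ℓ`. -/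
def reducedHyperplane (a : Ideal O) (j : Fin n) : Set (Fin ℓ → O ⧸ a) :=
  {y | ∃ x : Fin ℓ → O, (fun i => Ideal.Quotient.mk a (x i)) = y ∧ ∑ i, x i * c j i ∈ a}

/-- The complement `M(A(O/a))` of the `a`-reduced arrangement. -/
def complement (a : Ideal O) : Set (Fin ℓ → O ⧸ a) :=
  Set.univ \ ⋃ j, reducedHyperplane c a j

/-- The characteristic quasi-polynomial `a ↦ |M(A(O/a))|`. -/
def charQuasi (a : Ideal O) : ℤ := Nat.card (complement c a)

/-- `φ_J : O ^ ℓ → O ^ J`, `x ↦ (x c_j)_{j ∈ J}`. -/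
def phi (J : Finset (Fin n)) : (Fin ℓ → O) →ₗ[O] (J → O) :=
  LinearMap.pi fun j => Fintype.linearCombination O (c j)

/-- The cokernel of `φ_J`. -/
abbrev Coker (J : Finset (Fin n)) : Type _ := (J → O) ⧸ LinearMap.range (phi c J)

/-- `r(J)`, the rank of the image of `φ_J`. -/
def rk (J : Finset (Fin n)) : ℕ := Module.finrank O (LinearMap.range (phi c J))

/-- The ideals `d 0 ∣ d 1 ∣ ⋯ ∣ d (r(J) - 1)` are nonzero and the torsion submodule of the cokernel
of `φ_J` is isomorphic to the direct sum of the `O / d i`. These are the torsion invariants in the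
structure theorem for the finitely generated module `Coker c J`. -/
def IsInvariantFactors [IsDomain O] (J : Finset (Fin n)) (d : Fin (rk c J) → Ideal O) : Prop :=
  (∀ i, d i ≠ ⊥) ∧ (∀ i k, i ≤ k → d i ∣ d k) ∧
    Nonempty (Submodule.torsion O (Coker c J) ≃ₗ[O] (∀ i, O ⧸ d i))

open Classical in
/-- The invariant factors `d_{J,1} ∣ ⋯ ∣ d_{J,r(J)}` (indexed from `0`). -/
def invFactor [IsDomain O] (J : Finset (Fin n)) : Fin (rk c J) → Ideal O :=
  if h : ∃ d, IsInvariantFactors c J d then h.choose else fun _ => ⊥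

/-- The LCM-period `ρ_A`: the least common multiple (intersection) of the last invariant factors
`d_{J,r(J)}` over nonempty `J ⊆ [n]`. -/
def lcmPeriod [IsDomain O] : Ideal O :=
  ⨅ (J : Finset (Fin n)) (_ : J.Nonempty) (h : 0 < rk c J),
    invFactor c J ⟨rk c J - 1, Nat.sub_lt h Nat.one_pos⟩

/-- `m(J, a) = ∏ i, N(a + d_{J,i})`. -/
def mult [IsDomain O] (J : Finset (Fin n)) (a : Ideal O) : ℕ := ∏ i, idealNorm (a ⊔ invFactor c J i)

/-- The polynomial `f_A^κ(t) = ∑_{J ⊆ [n]} (-1)^{|J|} m(J, κ) t^{ℓ - r(J)}`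
(note that `r(J) ≤ ℓ`). -/
def constituent [IsDomain O] (κ : Ideal O) : Polynomial ℤ :=
  ∑ J : Finset (Fin n),
    Polynomial.C ((-1) ^ J.card * (mult c J κ : ℤ)) * Polynomial.X ^ (ℓ - rk c J)

end Quasi

/-! ## The torsion arrangement and its poset of layers -/

section Torsion

variable {O : Type*} [CommRing O] (K : Type*) [Field K] [Algebra O K]

/-- The `O`-module `K / O`. -/
abbrev KmodO (O : Type*) [CommRing O] (K : Type*) [Field K] [Algebra O K] : Type _ :=
  K ⧸ LinearMap.range (Algebra.linearMap O K)

/-- The projection `π : K ^ ℓ → (K / O) ^ ℓ`. -/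
def proj (O : Type*) [CommRing O] (K : Type*) [Field K] [Algebra O K] (ℓ : ℕ) :
    (Fin ℓ → K) →ₗ[O] (Fin ℓ → KmodO O K) :=
  (Submodule.mkQ (LinearMap.range (Algebra.linearMap O K))).compLeft (Fin ℓ)

variable {n ℓ : ℕ} (c : Fin n → Fin ℓ → O)

/-- The subspace `H_j = {x : x c_j = 0}` of `K ^ ℓ`. -/
def hyperplane (j : Fin n) : Submodule K (Fin ℓ → K) :=
  LinearMap.ker (Fintype.linearCombination K fun i => algebraMap O K (c j i))

/-- `H_J`, the intersection of the `H_j` with `j ∈ J`; it is `K ^ ℓ` for `J = ∅`. -/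
def flat (J : Finset (Fin n)) : Submodule K (Fin ℓ → K) := ⨅ j ∈ J, hyperplane K c j

/-- `T_j = {π(x) : x c_j ∈ O}`. -/
def torus (j : Fin n) : Set (Fin ℓ → KmodO O K) :=
  {z | ∃ x : Fin ℓ → K, proj O K ℓ x = z ∧
    ∑ i, x i * algebraMap O K (c j i) ∈ Set.range (algebraMap O K)}

/-- `T_J`, the intersection of the `T_j` with `j ∈ J`; it is `(K / O) ^ ℓ` for `J = ∅`. -/
def torusInter (J : Finset (Fin n)) : Set (Fin ℓ → KmodO O K) := ⋂ j ∈ J, torus K c j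

/-- `z + π(H)`, for `z ∈ (K / O) ^ ℓ` and a subspace `H` of `K ^ ℓ`. -/
def coset (O : Type*) [CommRing O] {K : Type*} [Field K] [Algebra O K] {ℓ : ℕ}
    (z : Fin ℓ → KmodO O K) (H : Submodule K (Fin ℓ → K)) : Set (Fin ℓ → KmodO O K) :=
  {y | ∃ h ∈ H, y = z + proj O K ℓ h}

/-- `Z` is a layer: a coset `z + π(H_J)` with `J ⊆ [n]` and `z ∈ T_J`. -/
def IsLayer (Z : Set (Fin ℓ → KmodO O K)) : Prop :=
  ∃ J : Finset (Fin n), ∃ z ∈ torusInter K c J, Z = coset O z (flat K c J)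

/-- The poset of layers `L(A(K/O))`. -/
def Layer : Type _ := {Z : Set (Fin ℓ → KmodO O K) // IsLayer K c Z}

variable {K c}

/-- Layers are ordered by reverse inclusion. -/
instance : PartialOrder (Layer K c) where
  le Z W := W.1 ⊆ Z.1
  le_refl Z := subset_rfl
  le_trans _ _ _ h₁ h₂ := h₂.trans h₁
  le_antisymm _ _ h₁ h₂ := Subtype.ext (h₂.antisymm h₁)

theorem coset_eq_of_mem {z w : Fin ℓ → KmodO O K} {H : Submodule K (Fin ℓ → K)}
    (hw : w ∈ coset O z H) : coset O z H = coset O w H := by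
  obtain ⟨h, hh, rfl⟩ := hw
  ext y
  constructor
  · rintro ⟨k, hk, rfl⟩
    exact ⟨k - h, H.sub_mem hk hh, by rw [map_sub]; abel⟩
  · rintro ⟨k, hk, rfl⟩
    exact ⟨h + k, H.add_mem hh hk, by rw [map_add]; abel⟩

theorem mem_coset_self (z : Fin ℓ → KmodO O K) (H : Submodule K (Fin ℓ → K)) :
    z ∈ coset O z H := ⟨0, H.zero_mem, by simp⟩

theorem Layer.exists_flat (Z : Layer K c) :
    ∃ H : Submodule K (Fin ℓ → K), (∃ J, H = flat K c J) ∧ ∀ z ∈ Z.1, Z.1 = coset O z H := by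
  obtain ⟨J, z, -, hZ⟩ := Z.2
  exact ⟨flat K c J, ⟨J, rfl⟩, fun w hw => by rw [hZ] at hw ⊢; exact coset_eq_of_mem hw⟩

/-- `H_Z`: the element of `L(A(K))` such that `Z = z + π(H_Z)` for all `z ∈ Z`. -/
def Layer.flat (Z : Layer K c) : Submodule K (Fin ℓ → K) := Z.exists_flat.choose

/-- `dim Z = dim H_Z`. -/
def Layer.dim (Z : Layer K c) : ℕ := Module.finrank K Z.flat

/-- `Z` is `κ`-torsion: `a Z ⊆ π(H_Z)` for all `a ∈ κ`. -/
def Layer.IsTorsion (Z : Layer K c) (κ : Ideal O) : Prop :=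
  ∀ a ∈ κ, ∀ z ∈ Z.1, a • z ∈ proj O K ℓ '' (Z.flat : Set (Fin ℓ → K))

variable (K c)

theorem proj_surjective : Function.Surjective (proj O K ℓ) := fun y => by
  choose x hx using fun i => Submodule.mkQ_surjective _ (y i)
  exact ⟨x, funext hx⟩

/-- The unique minimal layer `T_∅ = (K / O) ^ ℓ`. -/
def ambient : Layer K c := ⟨Set.univ, ∅, 0, by simp [torusInter], by
  symm
  rw [Set.eq_univ_iff_forall]
  intro y
  obtain ⟨x, rfl⟩ := proj_surjective K y
  exact ⟨x, by simp [TorsionArrangement.flat], by simp⟩⟩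

theorem finite_torsion [IsDomain O] [Ring.HasFiniteQuotients O]
    (M : Type*) [AddCommGroup M] [Module O M] [Module.Finite O M] :
    Finite (Submodule.torsion O M) := by
  obtain ⟨a, ha, ha'⟩ := Submodule.annihilator_top_inter_nonZeroDivisors
    (Submodule.torsion_isTorsion (R := O) (M := M))
  set I : Ideal O := (⊤ : Submodule O (Submodule.torsion O M)).annihilator with hI
  have : Finite (O ⧸ I) := Ring.HasFiniteQuotients.finiteQuotient fun h => by
    rw [h] at ha
    exact nonZeroDivisors.ne_zero ha' (by simpa using ha)
  have hT := Module.isTorsionBySet_annihilator_top O (Submodule.torsion O M)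
  let := hT.module
  have := hT.isScalarTower (S := O)
  have : Module.Finite (O ⧸ I) (Submodule.torsion O M) :=
    Module.Finite.of_restrictScalars_finite O _ _
  exact Module.finite_of_finite (O ⧸ I)

theorem mem_flat {J : Finset (Fin n)} {x : Fin ℓ → K} :
    x ∈ flat K c J ↔ ∀ j ∈ J, ∑ i, x i * algebraMap O K (c j i) = 0 := by
  simp [flat, hyperplane, Fintype.linearCombination_apply]

theorem proj_eq_zero {x : Fin ℓ → K} (a : Fin ℓ → O) (h : ∀ i, x i = algebraMap O K (a i)) :
    proj O K ℓ x = 0 := by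
  ext i
  exact (Submodule.Quotient.mk_eq_zero _).2 ⟨a i, (h i).symm⟩

/-- If `z ∈ T_J`, then `z = π(x)` with `x c_j ∈ O` for all `j ∈ J`. -/
theorem exists_lift_of_mem {J : Finset (Fin n)} {z : Fin ℓ → KmodO O K}
    (hz : z ∈ torusInter K c J) : ∃ x : Fin ℓ → K, proj O K ℓ x = z ∧ ∃ y : J → O,
      ∀ j : J, ∑ i, x i * algebraMap O K (c j i) = algebraMap O K (y j) := by
  obtain ⟨x, rfl⟩ := proj_surjective K z
  refine ⟨x, rfl, ?_⟩
  suffices ∀ j : J, ∃ y, ∑ i, x i * algebraMap O K (c j i) = algebraMap O K y by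
    choose y hy using this
    exact ⟨y, hy⟩
  intro j
  obtain ⟨x', hx', b, hb⟩ : proj O K ℓ x ∈ torus K c j := Set.mem_iInter₂.1 hz j j.2
  have h : ∀ i, ∃ a, algebraMap O K a = x i - x' i := fun i =>
    (Submodule.Quotient.eq _).1 (congrFun hx' i).symm
  choose a ha using h
  refine ⟨b + ∑ i, a i * c j i, ?_⟩
  rw [map_add, hb, map_sum, ← Finset.sum_add_distrib]
  refine Finset.sum_congr rfl fun i _ => ?_
  rw [map_mul, ha]
  ring

/-- Each `T_J` has only finitely many layers, as `O` has finite quotients. -/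
theorem finite_layers [IsDomain O] [Ring.HasFiniteQuotients O] [IsFractionRing O K] :
    Finite (Layer K c) := by
  have key : ∀ Z : Layer K c, ∃ p : (Σ J : Finset (Fin n), Submodule.torsion O (Coker c J)),
      ∃ x : Fin ℓ → K, ∃ y : p.1 → O,
        Z.1 = coset O (proj O K ℓ x) (flat K c p.1) ∧
        (∀ j : p.1, ∑ i, x i * algebraMap O K (c j i) = algebraMap O K (y j)) ∧
        (p.2 : Coker c p.1) = Submodule.Quotient.mk y := by
    intro Z
    obtain ⟨J, z, hz, hZ⟩ := Z.2
    obtain ⟨x, rfl, y, hy⟩ := exists_lift_of_mem K c hz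
    obtain ⟨b, hb⟩ := IsLocalization.exist_integer_multiples_of_finite (nonZeroDivisors O) x
    choose a ha using hb
    refine ⟨⟨J, ⟨Submodule.Quotient.mk y, ⟨b, ?_⟩⟩⟩, x, y, hZ, hy, rfl⟩
    refine (Submodule.Quotient.mk_eq_zero _).2 ⟨a, ?_⟩
    ext j
    apply IsFractionRing.injective O K
    have : algebraMap O K (((b : O) • y) j) = algebraMap O K b * algebraMap O K (y j) := by simp
    change _ = algebraMap O K (((b : O) • y) j)
    rw [this, ← hy, Finset.mul_sum]
    simp [phi, Fintype.linearCombination_apply, ha, Algebra.smul_def, mul_assoc]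
  choose p x y hZ hy hp using key
  have (J : Finset (Fin n)) : Finite (Submodule.torsion O (Coker c J)) := finite_torsion _
  refine Finite.of_injective p fun Z W h => Subtype.ext ?_
  have h' : ∃ a : Fin ℓ → O, ∀ j ∈ (p Z).1, ∑ i, (x Z i - x W i) * algebraMap O K (c j i) =
      ∑ i, algebraMap O K (a i) * algebraMap O K (c j i) := by
    have hyW := hy W
    have hpW := hp W
    revert hyW hpW
    generalize y W = yW
    revert yW
    rw [← h]
    intro yW hyW hpW
    rw [hp Z] at hpW
    obtain ⟨a, ha⟩ := (Submodule.Quotient.eq _).1 hpW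
    refine ⟨a, fun j hj => ?_⟩
    have := congrArg (algebraMap O K) (congrFun ha ⟨j, hj⟩)
    simp only [phi, LinearMap.pi_apply, Fintype.linearCombination_apply, smul_eq_mul, map_sum,
      map_mul, Pi.sub_apply, map_sub, ← hyW, ← hy Z ⟨j, hj⟩] at this
    rw [this, ← Finset.sum_sub_distrib]
    simp only [sub_mul]
  obtain ⟨a, ha⟩ := h'
  rw [hZ Z, hZ W, ← h]
  symm
  apply coset_eq_of_mem
  refine ⟨fun i => x Z i - x W i - algebraMap O K (a i), ?_, ?_⟩
  · rw [mem_flat]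
    intro j hj
    simp only [sub_mul _ (algebraMap O K (a _)), Finset.sum_sub_distrib, ha j hj, sub_self]
  · rw [← map_add, ← sub_eq_zero, ← map_sub]
    exact proj_eq_zero K a fun i => by simp only [Pi.sub_apply, Pi.add_apply]; ring

instance [IsDomain O] [Ring.HasFiniteQuotients O] [IsFractionRing O K] :
    Finite (Layer K c) := finite_layers K c

variable [IsDomain O] [Ring.HasFiniteQuotients O] [IsFractionRing O K]

instance : LocallyFiniteOrder (Layer K c) :=
  LocallyFiniteOrder.ofFiniteIcc fun _ _ => Set.toFinite _

open Classical in
/-- The Möbius function of the poset of layers. -/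
def mobius (Y Z : Layer K c) : ℤ := IncidenceAlgebra.mu ℤ Y Z

/-- The set of layers in `L(A(K/O))[κ]`. -/
def torsionLayers (κ : Ideal O) : Finset (Layer K c) :=
  (Set.toFinite {Z : Layer K c | Z.IsTorsion κ}).toFinset

/-- The `κ`-characteristic polynomial `∑_{Z ∈ L(A(K/O))[κ]} μ(T_∅, Z) t^{dim Z}`. -/
def torsionCharPoly (κ : Ideal O) : Polynomial ℤ :=
  ∑ Z ∈ torsionLayers K c κ,
    Polynomial.C (mobius K c (ambient K c) Z) * Polynomial.X ^ Z.dim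

/-- The characteristic polynomial `∑_{Z ∈ L(A(K/O))} μ(T_∅, Z) t^{dim Z}`. -/
def charPoly : Polynomial ℤ :=
  ∑ Z ∈ (Set.toFinite (Set.univ : Set (Layer K c))).toFinset,
    Polynomial.C (mobius K c (ambient K c) Z) * Polynomial.X ^ Z.dim

end Torsion

end

end TorsionArrangement

/-! Both polynomials are controlled by one module, the torsion of the cokernel of `φ_J`.

Quasi-polynomial side: by inclusion–exclusion it suffices to count, for each `J`, the solutions of
`y c_j = 0` (`j ∈ J`) modulo `a`. They form the kernel of `φ_J ⊗ O/a`, whose cokernel is `Coker φ_J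
⊗ O/a`. Since `Coker φ_J` is its torsion plus a projective module of rank `|J| - r(J)`, the kernel
has `m(J, a) N(a)^(ℓ - r(J))` elements (`card_solutions`). As `ρ ⊆ d_{J,i}`, the number `m(J, a)`
depends only on `a + ρ`.

Layer side: sending `x` to the class of `(x c_j)_{j ∈ J}` identifies the components of `T_J` with
the torsion of `Coker φ_J`, and `κ`-torsion layers with elements killed by `κ`
(`card_isComponent_isTorsion`). Since `O/d` has `N(κ + d)` such elements, `m(J, κ)` counts the
`κ`-torsion components of `T_J`. Moreover `μ(T_∅, Z)` is the sum of `(-1)^|J|` over the `J` having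
`Z` as a component of `T_J` (`mobius_ambient`); exchanging the two sums identifies the polynomials.

The invariants exist because a finite module splits off a cyclic summand `O/I` with its own
annihilator `I`, the ring `O/I` being self-injective. That `r(J)` of them suffice is read off from
fibres at maximal ideals. Uniqueness of the constituent holds because only finitely many ideals have
bounded norm. -/

namespace TorsionArrangement

open TensorProduct

/-! ### Cardinalities of the fibres `M / aM` -/

section TensorCard

variable {O : Type*} [CommRing O]

/-- The cardinality of `O / a ⊗ M`, that is, of `M / a M`. -/
noncomputable def fiberCard (a : Ideal O) (M : Type*) [AddCommGroup M] [Module O M] : ℕ :=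
  Nat.card ((O ⧸ a) ⊗[O] M)

variable (a : Ideal O) {M N : Type*} [AddCommGroup M] [Module O M] [AddCommGroup N] [Module O N]

theorem fiberCard_congr (e : M ≃ₗ[O] N) : fiberCard a M = fiberCard a N :=
  Nat.card_congr (e.lTensor (O ⧸ a)).toEquiv

theorem fiberCard_prod : fiberCard a (M × N) = fiberCard a M * fiberCard a N :=
  (Nat.card_congr (TensorProduct.prodRight O O (O ⧸ a) M N).toEquiv).trans (Nat.card_prod _ _)

theorem fiberCard_pi {ι : Type*} [Fintype ι] (M : ι → Type*) [∀ i, AddCommGroup (M i)]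
    [∀ i, Module O (M i)] : fiberCard a (∀ i, M i) = ∏ i, fiberCard a (M i) := by
  classical
  exact (Nat.card_congr (TensorProduct.piRight O O (O ⧸ a) M).toEquiv).trans Nat.card_pi

theorem finite_fiber [Finite (O ⧸ a)] [Module.Finite O M] : Finite ((O ⧸ a) ⊗[O] M) :=
  Module.finite_of_finite (O ⧸ a)

theorem fiberCard_le_of_surjective [Finite (O ⧸ a)] [Module.Finite O M] (f : M →ₗ[O] N)
    (hf : Function.Surjective f) : fiberCard a N ≤ fiberCard a M :=
  have := finite_fiber a (M := M)
  Nat.card_le_card_of_surjective _ (LinearMap.lTensor_surjective (O ⧸ a) hf)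

theorem fiberCard_quotient (d : Ideal O) : fiberCard a (O ⧸ d) = idealNorm (a ⊔ d) := by
  have h : (a • ⊤ : Submodule O (O ⧸ d)) =
      (a.map (Ideal.Quotient.mk d)).restrictScalars O := by
    simp [Ideal.smul_top_eq_map]
  exact Nat.card_congr (((TensorProduct.quotTensorEquivQuotSMul (O ⧸ d) a).toEquiv.trans
    (Submodule.quotEquivOfEq _ _ h).toEquiv).trans
    ((DoubleQuot.quotQuotEquivQuotSup d a).toEquiv.trans
      (Ideal.quotEquivOfEq (sup_comm d a)).toEquiv))

end TensorCard

/-! ### Fibres of torsion-free modules, ideal norms, `κ`-torsion of `O / d` -/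

section Dedekind

variable {O : Type*} [CommRing O] [IsDedekindDomain O]

/-- The finite ring `O / a` is semilocal, and `P` is flat with fibres of the same dimension at every
prime. A finite flat module of constant fibre dimension over a semilocal ring is free. -/
theorem basis_fiber (a : Ideal O) [Finite (O ⧸ a)] (P : Type*) [AddCommGroup P] [Module O P]
    [Module.Finite O P] [Module.IsTorsionFree O P] :
    Nonempty (Module.Basis (Fin (Module.finrank O P)) (O ⧸ a) ((O ⧸ a) ⊗[O] P)) := by
  apply Module.nonempty_basis_of_flat_of_finrank_eq
  intro m
  let := Ideal.Quotient.field m.1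
  have h := congrFun (Module.rankAtStalk_eq_finrank_of_free
    (R := (O ⧸ a) ⧸ m.1) (M := ((O ⧸ a) ⧸ m.1) ⊗[O ⧸ a] ((O ⧸ a) ⊗[O] P))) ⊥
  rw [Module.rankAtStalk_baseChange, Module.rankAtStalk_baseChange] at h
  have h' := Ideal.finrank_fiber_eq_finrank (M := P) (PrimeSpectrum.comap (algebraMap O (O ⧸ a))
    (PrimeSpectrum.comap (algebraMap (O ⧸ a) ((O ⧸ a) ⧸ m.1)) ⊥)).asIdeal
  rw [Ideal.finrank_fiber_eq_rankAtStalk] at h'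
  exact h.symm.trans h'

theorem fiberCard_of_isTorsionFree (a : Ideal O) [Finite (O ⧸ a)] (P : Type*) [AddCommGroup P]
    [Module O P] [Module.Finite O P] [Module.IsTorsionFree O P] :
    fiberCard a P = idealNorm a ^ Module.finrank O P := by
  obtain ⟨b⟩ := basis_fiber a P
  rw [fiberCard, Nat.card_congr b.equivFun.toEquiv]
  simp [idealNorm, Nat.card_fun]

/-- Infiniteness gives the zero ideal norm `0`, so no ideal has to be excluded. -/
theorem idealNorm_mul [Infinite O] (I J : Ideal O) :
    idealNorm (I * J) = idealNorm I * idealNorm J :=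
  UniqueFactorizationMonoid.multiplicative_of_coprime Submodule.cardQuot I J
    (Submodule.cardQuot_bot _ _)
    (fun {I J} hI => by simp [Ideal.isUnit_iff.mp hI, Ideal.mul_top])
    (fun {I} i hI =>
      have : Ideal.IsPrime I := Ideal.isPrime_of_prime hI
      cardQuot_pow_of_prime hI.ne_zero)
    fun {I J} hIJ => cardQuot_mul_of_coprime <| Ideal.isCoprime_iff_sup_eq.mpr
      (Ideal.isUnit_iff.mp
        (hIJ (Ideal.dvd_iff_le.mpr le_sup_left) (Ideal.dvd_iff_le.mpr le_sup_right)))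

theorem mul_le_mul_iff_left_of_ne_bot {I J L : Ideal O} (hL : L ≠ ⊥) :
    L * I ≤ L * J ↔ I ≤ J := by
  rw [← Ideal.dvd_iff_le, ← Ideal.dvd_iff_le, mul_dvd_mul_iff_left hL]

/-- The `κ`-torsion of `O / d` has `N(κ + d)` elements. -/
theorem card_torsion_quotient [Infinite O] [Ring.HasFiniteQuotients O] (κ : Ideal O) {d : Ideal O}
    (hd : d ≠ ⊥) : Nat.card {x : O ⧸ d // ∀ b ∈ κ, b • x = 0} = idealNorm (κ ⊔ d) := by
  obtain ⟨L, hL⟩ := Ideal.dvd_iff_le.2 (le_sup_right : d ≤ κ ⊔ d)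
  have hdL : d ≤ L := Ideal.dvd_iff_le.1 ⟨κ ⊔ d, by rw [mul_comm]; exact hL⟩
  have hI : κ ⊔ d ≠ ⊥ := fun h => hd (by rw [hL, h, Ideal.bot_mul])
  have hL0 : L ≠ ⊥ := fun h => hd (by rw [hL, h, Ideal.mul_bot])
  have := Ring.HasFiniteQuotients.finiteQuotient hd
  have := Ring.HasFiniteQuotients.finiteQuotient hL0
  -- With `d = (κ + d) L`, cancelling `κ + d` shows that `κ x ⊆ d` exactly when `x ∈ L`. So the
  -- `κ`-torsion is the kernel of `O / d → O / L`, of order `N(d) / N(L) = N(κ + d)`.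
  have key : ∀ x : O ⧸ d, (∀ b ∈ κ, b • x = 0) ↔ x ∈ (Submodule.factor hdL).ker := by
    intro x
    obtain ⟨x, rfl⟩ := Submodule.Quotient.mk_surjective _ x
    rw [LinearMap.mem_ker]
    change _ ↔ Submodule.Quotient.mk x = 0
    rw [Submodule.Quotient.mk_eq_zero, ← Ideal.span_singleton_le_iff_mem,
      ← mul_le_mul_iff_left_of_ne_bot hI, ← hL]
    simp only [← Submodule.Quotient.mk_smul, Submodule.Quotient.mk_eq_zero]
    rw [Ideal.sup_mul, sup_le_iff, and_iff_left (Ideal.mul_le_left : d * Ideal.span {x} ≤ d), Ideal.mul_le]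
    constructor
    · intro h r hr s hs
      obtain ⟨t, rfl⟩ := Ideal.mem_span_singleton'.1 hs
      rw [mul_left_comm]
      exact d.mul_mem_left _ (h r hr)
    · exact fun h b hb => h b hb x (Ideal.mem_span_singleton_self x)
  rw [Nat.card_congr (Equiv.subtypeEquivRight key)]
  have h1 : Nat.card (O ⧸ d) = Nat.card (Submodule.factor hdL).ker * Nat.card (O ⧸ L) := by
    rw [Submodule.card_eq_card_quotient_mul_card (Submodule.factor hdL).ker,
      Nat.card_congr ((Submodule.factor hdL).quotKerEquivOfSurjective
        (Submodule.factor_surjective hdL)).toEquiv, mul_comm]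
  have h2 : Nat.card (O ⧸ d) = idealNorm (κ ⊔ d) * Nat.card (O ⧸ L) := by
    conv_lhs => rw [hL]
    exact idealNorm_mul _ _
  exact Nat.eq_of_mul_eq_mul_right Nat.card_pos (h1.symm.trans h2)

end Dedekind

/-! ### Structure theorem for finite modules -/

section Structure

universe u v

variable {O : Type u} [CommRing O] [IsDedekindDomain O]

theorem infinite_of_not_isField (hO : ¬ IsField O) : Infinite O := by
  by_contra h
  rw [not_infinite_iff_finite] at h
  exact hO (Finite.isField_of_domain O)

/-- Every ideal of `O / d` is generated by one element `a`; let `J = d + (a)`, `d = J L`, and let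
`y` lift `g(a)`. From `L a ⊆ d` follows `L y ⊆ d = L J`, so `y ∈ J` after cancelling `L`. Hence
`g(a) = r a` for some `r`, and `g` is multiplication by `r`. -/
theorem baer_quotient {d : Ideal O} (hd : d ≠ ⊥) : Module.Baer (O ⧸ d) (O ⧸ d) := by
  intro I g
  set J : Ideal O := I.comap (Ideal.Quotient.mk d) with hJ
  have hdJ : d ≤ J := fun x hx => by
    rw [hJ, Ideal.mem_comap, Ideal.Quotient.eq_zero_iff_mem.2 hx]
    exact I.zero_mem
  obtain ⟨a, ha⟩ := IsDedekindDomain.exists_sup_span_eq hdJ hd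
  have haI : Ideal.Quotient.mk d a ∈ I := by
    have : a ∈ J := ha ▸ Ideal.mem_sup_right (Ideal.mem_span_singleton_self a)
    exact this
  obtain ⟨L, hL⟩ := Ideal.dvd_iff_le.2 hdJ
  have hL0 : L ≠ ⊥ := fun h => hd (by rw [hL, h, Ideal.mul_bot])
  obtain ⟨y, hy⟩ := Ideal.Quotient.mk_surjective (g ⟨_, haI⟩)
  have hyJ : y ∈ J := by
    rw [← Ideal.span_singleton_le_iff_mem, ← mul_le_mul_iff_left_of_ne_bot hL0, mul_comm L J, ← hL,
      Ideal.mul_le]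
    intro l hl s hs
    obtain ⟨t, rfl⟩ := Ideal.mem_span_singleton'.1 hs
    rw [mul_left_comm]
    refine d.mul_mem_left _ (Ideal.Quotient.eq_zero_iff_mem.1 ?_)
    rw [map_mul, hy, ← smul_eq_mul, ← map_smul]
    convert! map_zero g
    refine Subtype.ext ?_
    change Ideal.Quotient.mk d l * Ideal.Quotient.mk d a = 0
    rw [← map_mul, Ideal.Quotient.eq_zero_iff_mem, hL]
    exact Ideal.mul_mem_mul_rev (show a ∈ J from haI) hl
  rw [← ha] at hyJ
  obtain ⟨e, he, f, hf, hef⟩ := Submodule.mem_sup.1 hyJ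
  obtain ⟨r, rfl⟩ := Ideal.mem_span_singleton'.1 hf
  refine ⟨LinearMap.mulLeft (O ⧸ d) (Ideal.Quotient.mk d r), fun x hx => ?_⟩
  obtain ⟨x, rfl⟩ := Ideal.Quotient.mk_surjective x
  have hxJ : x ∈ J := hx
  rw [← ha] at hxJ
  obtain ⟨e', he', f', hf', rfl⟩ := Submodule.mem_sup.1 hxJ
  obtain ⟨s, rfl⟩ := Ideal.mem_span_singleton'.1 hf'
  have h1 : Ideal.Quotient.mk d (e' + s * a) = Ideal.Quotient.mk d s * Ideal.Quotient.mk d a := by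
    rw [map_add, Ideal.Quotient.eq_zero_iff_mem.2 he', zero_add, map_mul]
  have h2 : Ideal.Quotient.mk d y = Ideal.Quotient.mk d r * Ideal.Quotient.mk d a := by
    rw [← hef, map_add, Ideal.Quotient.eq_zero_iff_mem.2 he, zero_add, map_mul]
  have h3 : (⟨_, hx⟩ : I) = Ideal.Quotient.mk d s • ⟨_, haI⟩ := Subtype.ext h1
  rw [h3, map_smul, ← hy, h2, LinearMap.mulLeft_apply, h1, smul_eq_mul]
  ring

/-- A retraction splits a module. -/
def equivProdKerOfLeftInverse {R M P : Type*} [Ring R] [AddCommGroup M] [AddCommGroup P]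
    [Module R M] [Module R P] (f : M →ₗ[R] P) (s : P →ₗ[R] M) (h : ∀ p, f (s p) = p) :
    M ≃ₗ[R] P × LinearMap.ker f where
  toFun m := (f m, ⟨m - s (f m), by simp [h]⟩)
  invFun p := s p.1 + p.2
  map_add' x y := by ext <;> simp; abel
  map_smul' r x := by ext <;> simp [smul_sub]
  left_inv m := by simp
  right_inv p := by
    obtain ⟨p, k, hk⟩ := p
    have : f k = 0 := hk
    ext <;> simp [h, this]

variable {M : Type v} [AddCommGroup M] [Module O M]

/-- Choose `u` with `D E + (u) = D`. Then `b u ∈ D E` is equivalent to `b D ⊆ D E`, that is, to `b ∈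
E`. -/
theorem exists_torsionOf_smul_eq {x : M} {D E : Ideal O}
    (h : Ideal.torsionOf O M x = D * E) (h0 : D * E ≠ ⊥) :
    ∃ u : O, Ideal.torsionOf O M (u • x) = E := by
  have hD : D ≠ ⊥ := fun h => h0 (by rw [h, Ideal.bot_mul])
  obtain ⟨u, hu⟩ := IsDedekindDomain.exists_sup_span_eq
    (Ideal.mul_le_left : D * E ≤ D) h0
  refine ⟨u, ?_⟩
  ext b
  rw [Ideal.mem_torsionOf_iff, smul_smul, ← Ideal.mem_torsionOf_iff, h,
    ← Ideal.span_singleton_le_iff_mem (I := E), ← mul_le_mul_iff_left_of_ne_bot hD]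
  nth_rw 2 [← hu]
  rw [Ideal.sup_mul, sup_le_iff,
    and_iff_right (Ideal.mul_le_left : D * E * Ideal.span {b} ≤ D * E),
    Ideal.span_singleton_mul_span_singleton, Ideal.span_singleton_le_iff_mem, mul_comm b]

variable (O M) in
/-- A finite module has an element whose annihilator kills the whole module. -/
theorem exists_torsionOf_le [Infinite O] [Finite M] :
    ∃ x : M, Ideal.torsionOf O M x ≠ ⊥ ∧ ∀ y : M, Ideal.torsionOf O M x ≤ Ideal.torsionOf O M y := by
  have hne : ∀ x : M, Ideal.torsionOf O M x ≠ ⊥ := by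
    intro x h
    have : Function.Injective (LinearMap.toSpanSingleton O M x) := LinearMap.ker_eq_bot.1 h
    have := Finite.of_injective _ this
    exact not_finite O
  -- An `x` with minimal annihilator works. Otherwise some prime `p` divides `Ann y` more often than
  -- `Ann x = p^j A`; multiples of `x` and `y` with the coprime annihilators `A` and `p^(j+1)` then
  -- add up to an element whose annihilator is strictly smaller than `Ann x`.
  obtain ⟨_, ⟨x, rfl⟩, hx⟩ :=
    (Set.finite_range (Ideal.torsionOf O M)).exists_minimal (Set.range_nonempty _)
  refine ⟨x, hne x, fun y => ?_⟩
  by_contra hxy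
  rw [← Ideal.dvd_iff_le, UniqueFactorizationMonoid.dvd_iff_emultiplicity_le (hne y)] at hxy
  push Not at hxy
  obtain ⟨p, hp, hlt⟩ := hxy
  have hfin : FiniteMultiplicity p (Ideal.torsionOf O M x) :=
    FiniteMultiplicity.of_prime_left hp (hne x)
  obtain ⟨A, hA, hpA⟩ := hfin.exists_eq_pow_mul_and_not_dvd
  set j := multiplicity p (Ideal.torsionOf O M x)
  have hdvd : p ^ (j + 1) ∣ Ideal.torsionOf O M y := by
    apply pow_dvd_of_le_emultiplicity
    rw [hfin.emultiplicity_eq_multiplicity] at hlt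
    exact Order.add_one_le_of_lt hlt
  obtain ⟨B, hB⟩ := hdvd
  obtain ⟨u, hu⟩ := exists_torsionOf_smul_eq hA (hA ▸ hne x)
  obtain ⟨w, hw⟩ := exists_torsionOf_smul_eq (hB.trans (mul_comm _ _))
    (by rw [mul_comm, ← hB]; exact hne y)
  have := Ideal.isPrime_of_prime hp
  have hmax : p.IsMaximal := this.isMaximal hp.ne_zero
  have hcop : A ⊔ p ^ (j + 1) = ⊤ := by
    rw [← Ideal.isCoprime_iff_sup_eq]
    apply IsCoprime.pow_right
    rw [Ideal.isCoprime_iff_sup_eq, sup_comm]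
    exact hmax.out.2 _ (left_lt_sup.2 fun h => hpA (Ideal.dvd_iff_le.2 h))
  have hz : Ideal.torsionOf O M (u • x + w • y) ≤ A ⊓ p ^ (j + 1) := by
    intro b hb
    rw [Ideal.mem_torsionOf_iff] at hb
    obtain ⟨e, he, f, hf, hef⟩ := Submodule.mem_sup.1
      (show (1 : O) ∈ A ⊔ p ^ (j + 1) by rw [hcop]; trivial)
    rw [← hu, Ideal.mem_torsionOf_iff] at he
    rw [← hw, Ideal.mem_torsionOf_iff] at hf
    have h1 : (e * b) • (w • y) = 0 := by
      have : e • b • (u • x + w • y) = 0 := by rw [hb, smul_zero]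
      rwa [smul_add, smul_add, smul_comm e b, he, smul_zero, zero_add, smul_smul] at this
    have h2 : (f * b) • (u • x) = 0 := by
      have : f • b • (u • x + w • y) = 0 := by rw [hb, smul_zero]
      rwa [smul_add, smul_add, smul_comm f b (w • y), hf, smul_zero, add_zero, smul_smul] at this
    refine ⟨?_, ?_⟩
    · change b ∈ A
      rw [← hu, Ideal.mem_torsionOf_iff, ← one_mul b, ← hef, add_mul, add_smul, h2, add_zero,
        mul_comm, mul_smul, he, smul_zero]
    · change b ∈ p ^ (j + 1)
      rw [← hw, Ideal.mem_torsionOf_iff, ← one_mul b, ← hef, add_mul, add_smul, h1, zero_add,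
        mul_comm, mul_smul, hf, smul_zero]
  have hle : A ⊓ p ^ (j + 1) ≤ Ideal.torsionOf O M x := by
    rw [← Ideal.mul_eq_inf_of_isCoprime (Ideal.isCoprime_iff_sup_eq.2 hcop), hA, mul_comm]
    exact Ideal.mul_mono_left (Ideal.pow_le_pow_right j.le_succ)
  have h3 := (hx ⟨_, rfl⟩ (hz.trans hle)).trans (hz.trans inf_le_right)
  rw [← Ideal.dvd_iff_le, hA, pow_succ] at h3
  exact hpA ((mul_dvd_mul_iff_left (pow_ne_zero _ hp.ne_zero)).1 h3)

variable (O M) in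
/-- A finite module splits off a cyclic module with the same annihilator. -/
theorem exists_equiv_quotient_prod [Infinite O] [Finite M] :
    ∃ (I : Ideal O) (N : Submodule O M), I ≠ ⊥ ∧ (∀ b ∈ I, ∀ y : M, b • y = 0) ∧
      Nonempty (M ≃ₗ[O] (O ⧸ I) × N) := by
  obtain ⟨x, hx0, hx⟩ := exists_torsionOf_le O M
  set I := Ideal.torsionOf O M x with hI
  have hT : Module.IsTorsionBySet O M (I : Set O) := fun y b => hx y b.2
  let := hT.module
  have hsc : IsScalarTower O (O ⧸ I) M := hT.isScalarTower
  have hinj : Function.Injective (LinearMap.toSpanSingleton (O ⧸ I) M x) := by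
    rw [← LinearMap.ker_eq_bot, eq_bot_iff]
    intro b hb
    obtain ⟨b, rfl⟩ := Ideal.Quotient.mk_surjective b
    have : b • x = 0 := hb
    exact Ideal.Quotient.eq_zero_iff_mem.2 this
  -- Self-injectivity of `O / I` makes the embedding `1 ↦ x` of `O / I` into `M` split.
  obtain ⟨f, hf⟩ := (baer_quotient hx0).extension_property _ hinj LinearMap.id
  exact ⟨I, (LinearMap.ker (f.restrictScalars O)), hx0, fun b hb y => hx y hb,
    ⟨equivProdKerOfLeftInverse (f.restrictScalars O)
      ((LinearMap.toSpanSingleton (O ⧸ I) M x).restrictScalars O)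
      fun p => LinearMap.congr_fun hf p⟩⟩

theorem fiberCard_pos [Finite M] (a : Ideal O) [Finite (O ⧸ a)] : 0 < fiberCard a M :=
  have := finite_fiber a (M := M)
  Nat.card_pos

/-- Structure theorem for finite modules, with control of the number of invariant factors. -/
theorem exists_equiv_pi_quotient [Ring.HasFiniteQuotients O] (hO : ¬ IsField O) (r : ℕ) :
    ∀ (M : Type v) [AddCommGroup M] [Module O M] [Finite M],
    (∀ p : Ideal O, p.IsMaximal → fiberCard p M ≤ idealNorm p ^ r) →
    ∃ d : Fin r → Ideal O, (∀ i, d i ≠ ⊥) ∧ (∀ i k, i ≤ k → d k ∣ d i) ∧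
      Nonempty (M ≃ₗ[O] (∀ i, O ⧸ d i)) := by
  have := infinite_of_not_isField hO
  induction r with
  | zero =>
    intro M _ _ _ h
    obtain ⟨I, N, hI, hIM, ⟨e⟩⟩ := exists_equiv_quotient_prod O M
    -- A maximal ideal `p` containing `I` would contribute a factor `N(p) > 1` to a fibre of order
    -- at most `1`.
    have hItop : I = ⊤ := by
      by_contra hne
      obtain ⟨p, hp, hIp⟩ := Ideal.exists_le_maximal I hne
      have hp0 := Ring.ne_bot_of_isMaximal_of_not_isField hp hO
      have := Ring.HasFiniteQuotients.finiteQuotient hp0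
      have h1 := h p hp
      rw [fiberCard_congr p e, fiberCard_prod, fiberCard_quotient, sup_eq_left.2 hIp,
        pow_zero] at h1
      have h2 : 1 < idealNorm p := by
        have := Ideal.Quotient.nontrivial_iff.2 hp.ne_top
        exact Finite.one_lt_card
      have h3 := fiberCard_pos (M := N) p
      nlinarith
    have : Subsingleton M := ⟨fun x y => by
      have : ∀ z : M, z = 0 := fun z => by
        rw [← one_smul O z]; exact hIM 1 (hItop ▸ trivial) z
      rw [this x, this y]⟩
    exact ⟨fun _ => ⊤, fun i => i.elim0, fun i => i.elim0, ⟨LinearEquiv.ofSubsingleton _ _⟩⟩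
  | succ r ih =>
    intro M _ _ _ h
    obtain ⟨I, N, hI, hIM, ⟨e⟩⟩ := exists_equiv_quotient_prod O M
    -- The bound drops by one factor: if `I ⊆ p`, the summand `O / I` uses up one `N(p)`; otherwise
    -- `p + I = O` and, as `I` kills `N`, the fibre of `N` at `p` is trivial.
    obtain ⟨d, hd0, hd, ⟨e'⟩⟩ := ih N fun p hp => by
      have hp0 := Ring.ne_bot_of_isMaximal_of_not_isField hp hO
      have := Ring.HasFiniteQuotients.finiteQuotient hp0
      have h1 := h p hp
      have hpos : 0 < idealNorm p := Nat.card_pos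
      rw [fiberCard_congr p e, fiberCard_prod, fiberCard_quotient] at h1
      by_cases hIp : I ≤ p
      · rw [sup_eq_left.2 hIp, pow_succ'] at h1
        exact Nat.le_of_mul_le_mul_left h1 hpos
      · obtain ⟨i, hi, j, hj, hij⟩ := Submodule.mem_sup.1 (show (1 : O) ∈ p ⊔ I by
          rw [hp.out.2 _ (left_lt_sup.2 hIp)]; trivial)
        have : Subsingleton ((O ⧸ p) ⊗[O] N) := subsingleton_of_forall_eq 0 fun t => by
          induction t with
          | zero => rfl
          | add x y hx hy => rw [hx, hy, add_zero]
          | tmul x n =>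
            have h1 : i • x = 0 := by
              obtain ⟨x, rfl⟩ := Ideal.Quotient.mk_surjective x
              exact Ideal.Quotient.eq_zero_iff_mem.2 (p.mul_mem_right x hi)
            have h2 : j • n = 0 := Subtype.ext (hIM j hj n)
            rw [← one_smul O (x ⊗ₜ[O] n), ← hij, add_smul, smul_tmul', h1, zero_tmul, zero_add,
              ← tmul_smul, h2, tmul_zero]
        have : fiberCard p N = 1 := Nat.card_of_subsingleton 0
        rw [this]
        exact Nat.one_le_pow _ _ hpos
    refine ⟨Fin.cons I d, ?_, ?_, ⟨?_⟩⟩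
    · intro i
      refine Fin.cases ?_ ?_ i
      · exact hI
      · exact hd0
    · have hdI : ∀ i, d i ∣ I := fun i => by
        rw [Ideal.dvd_iff_le]
        intro b hb
        have h1 : b • e'.symm (Pi.single i 1) = 0 := Subtype.ext (hIM b hb _)
        rw [← map_smul, LinearEquiv.map_eq_zero_iff] at h1
        have h2 := congrFun h1 i
        rw [Pi.smul_apply, Pi.single_eq_same] at h2
        rw [← Ideal.Quotient.eq_zero_iff_mem, ← mul_one b]
        exact h2
      intro i k
      refine Fin.cases ?_ (fun i => ?_) i <;> refine Fin.cases ?_ (fun k => ?_) k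
      · simp
      · intro _; exact hdI k
      · intro h; exact absurd h (by simp)
      · intro h; exact hd i k (Fin.succ_le_succ_iff.1 h)
    · exact (e.trans ((LinearEquiv.refl O _).prodCongr e')).trans
        (Fin.consLinearEquiv O fun i => O ⧸ (Fin.cons I d : Fin (r + 1) → Ideal O) i)

end Structure

/-! ### Solutions of congruences and the constituents `f^κ` -/

section Counting

variable {O : Type*} [CommRing O] [IsDedekindDomain O]

theorem finrank_quotient_torsion (M : Type*) [AddCommGroup M] [Module O M] [Module.Finite O M] :
    Module.finrank O (M ⧸ Submodule.torsion O M) = Module.finrank O M := by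
  have h : Module.finrank O (Submodule.torsion O M) = 0 :=
    Module.finrank_eq_zero_iff_isTorsion.2 Submodule.torsion_isTorsion
  rw [← (Submodule.torsion O M).finrank_quotient_add_finrank, h, add_zero]

/-- The quotient by the torsion is finite and torsion-free, hence projective, so the torsion splits
off. -/
theorem fiberCard_eq_torsion_mul (a : Ideal O) [Finite (O ⧸ a)] (M : Type*) [AddCommGroup M]
    [Module O M] [Module.Finite O M] :
    fiberCard a M = fiberCard a (Submodule.torsion O M) * idealNorm a ^ Module.finrank O M := by
  have := Module.finitePresentation_of_finite O (M ⧸ Submodule.torsion O M)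
  have := Module.Flat.projective_of_finitePresentation (R := O) (M := M ⧸ Submodule.torsion O M)
  obtain ⟨s, hs⟩ := Module.projective_lifting_property (Submodule.torsion O M).mkQ LinearMap.id
    (Submodule.mkQ_surjective _)
  rw [fiberCard_congr a (equivProdKerOfLeftInverse (Submodule.torsion O M).mkQ s
    (LinearMap.congr_fun hs)), fiberCard_prod,
    fiberCard_of_isTorsionFree, finrank_quotient_torsion, mul_comm, Submodule.ker_mkQ]

variable {n ℓ : ℕ} (c : Fin n → Fin ℓ → O) (J : Finset (Fin n))

theorem finrank_coker_add_rk : Module.finrank O (Coker c J) + rk c J = J.card := by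
  rw [rk, Submodule.finrank_quotient_add_finrank]
  simp

theorem rk_le : rk c J ≤ ℓ :=
  (LinearMap.finrank_range_le (phi c J)).trans_eq (by simp)

/-- The torsion is a quotient of `S`, the saturation of the image of `φ_J` in `O ^ J`, which is
torsion-free of rank `r(J)`. This is why `r(J)` invariant factors suffice. -/
theorem fiberCard_torsion_coker_le (a : Ideal O) [Finite (O ⧸ a)] :
    fiberCard a (Submodule.torsion O (Coker c J)) ≤ idealNorm a ^ rk c J := by
  set N := LinearMap.range (phi c J)
  set S : Submodule O (J → O) := (Submodule.torsion O (Coker c J)).comap N.mkQ with hS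
  have hrk : Module.finrank O S = rk c J := by
    have h1 := S.finrank_quotient_add_finrank
    have e : ((J → O) ⧸ S) ≃ₗ[O] Coker c J ⧸ Submodule.torsion O (Coker c J) :=
      LinearEquiv.ofBijective (S.mapQ (Submodule.torsion O (Coker c J)) N.mkQ le_rfl) <| by
        constructor
        · rw [← LinearMap.ker_eq_bot, Submodule.mapQ, Submodule.ker_liftQ, LinearMap.ker_comp,
            Submodule.ker_mkQ, Submodule.mkQ_map_self]
        · intro y
          obtain ⟨y, rfl⟩ := Submodule.mkQ_surjective _ y
          obtain ⟨y, rfl⟩ := Submodule.mkQ_surjective _ y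
          exact ⟨S.mkQ y, rfl⟩
    rw [e.finrank_eq, finrank_quotient_torsion] at h1
    have h2 := finrank_coker_add_rk c J
    simp only [Module.finrank_fintype_fun_eq_card, Fintype.card_coe] at h1
    omega
  rw [← hrk, ← fiberCard_of_isTorsionFree]
  refine fiberCard_le_of_surjective a (N.mkQ.restrict (p := S) fun x hx => hx) ?_
  rintro ⟨y, hy⟩
  obtain ⟨y, rfl⟩ := N.mkQ_surjective y
  exact ⟨⟨y, hy⟩, rfl⟩

variable [Ring.HasFiniteQuotients O]

theorem isInvariantFactors_invFactor (hO : ¬ IsField O) :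
    IsInvariantFactors c J (invFactor c J) := by
  have h : ∃ d, IsInvariantFactors c J d := by
    have : Finite (Submodule.torsion O (Coker c J)) := finite_torsion _
    obtain ⟨d, h0, hd, ⟨e⟩⟩ := exists_equiv_pi_quotient hO (rk c J)
      (Submodule.torsion O (Coker c J)) fun p hp => by
        have := Ring.HasFiniteQuotients.finiteQuotient
          (Ring.ne_bot_of_isMaximal_of_not_isField hp hO)
        exact fiberCard_torsion_coker_le c J p
    -- The structure theorem lists each ideal before its divisors, so the order is reversed.
    exact ⟨fun i => d i.rev, fun i => h0 _, fun i k hik => hd _ _ (Fin.rev_le_rev.2 hik),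
      ⟨e.trans (LinearEquiv.piCongrLeft O (fun i => O ⧸ d i) Fin.revPerm).symm⟩⟩
  rw [invFactor, dif_pos h]
  exact h.choose_spec

/-- The solutions of the congruences `y c_j = 0`, `j ∈ J`, in `(O / a) ^ ℓ`. -/
def solutions (a : Ideal O) : Set (Fin ℓ → O ⧸ a) :=
  {y | ∀ j ∈ J, ∑ i, y i * Ideal.Quotient.mk a (c j i) = 0}

omit [IsDedekindDomain O] [Ring.HasFiniteQuotients O] in
theorem piScalarRight_lTensor_phi (a : Ideal O) (t : (O ⧸ a) ⊗[O] (Fin ℓ → O)) (j : J) :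
    TensorProduct.piScalarRight O O (O ⧸ a) J ((phi c J).lTensor (O ⧸ a) t) j =
      ∑ i, TensorProduct.piScalarRight O O (O ⧸ a) (Fin ℓ) t i * Ideal.Quotient.mk a (c j i) := by
  induction t with
  | zero => simp
  | add x y hx hy => simp only [map_add, Pi.add_apply, hx, hy, add_mul, Finset.sum_add_distrib]
  | tmul r x =>
    simp only [LinearMap.lTensor_tmul, piScalarRight_apply, piScalarRightHom_tmul, phi,
      LinearMap.pi_apply, Fintype.linearCombination_apply, Finset.sum_smul]
    refine Finset.sum_congr rfl fun i _ => ?_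
    simp only [Algebra.smul_def, Ideal.Quotient.algebraMap_eq, map_mul, Algebra.algebraMap_self_apply]
    ring

/-- The kernel of `φ_J ⊗ O/a` is counted through its cokernel, which is `O/a ⊗ Coker φ_J` by right
exactness: source and target have `N(a)^ℓ` and `N(a)^|J|` elements. -/
theorem card_solutions (hO : ¬ IsField O) {a : Ideal O} (ha : a ≠ ⊥) :
    Nat.card (solutions c J a) = mult c J a * idealNorm a ^ (ℓ - rk c J) := by
  have := Ring.HasFiniteQuotients.finiteQuotient ha
  set f := (phi c J).lTensor (O ⧸ a)
  have e : LinearMap.ker f ≃ solutions c J a :=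
    (TensorProduct.piScalarRight O O (O ⧸ a) (Fin ℓ)).toEquiv.subtypeEquiv fun t => by
      rw [LinearMap.mem_ker,
        ← (TensorProduct.piScalarRight O O (O ⧸ a) J).map_eq_zero_iff, funext_iff]
      simp only [f, piScalarRight_lTensor_phi, Subtype.forall]
      rfl
  have hV : Nat.card ((O ⧸ a) ⊗[O] (Fin ℓ → O)) = idealNorm a ^ ℓ := by
    rw [Nat.card_congr (TensorProduct.piScalarRight O O (O ⧸ a) (Fin ℓ)).toEquiv]
    simp [idealNorm, Nat.card_fun]
  have hW : Nat.card ((O ⧸ a) ⊗[O] (J → O)) = idealNorm a ^ J.card := by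
    rw [Nat.card_congr (TensorProduct.piScalarRight O O (O ⧸ a) J).toEquiv]
    simp [idealNorm, Nat.card_fun]
  rw [Submodule.card_eq_card_quotient_mul_card (LinearMap.ker f),
    Nat.card_congr f.quotKerEquivRange.toEquiv] at hV
  have hex : Function.Exact (phi c J) (LinearMap.range (phi c J)).mkQ :=
    LinearMap.exact_iff.2 (Submodule.ker_mkQ _)
  have hC := fiberCard_eq_torsion_mul a (Coker c J)
  have hT : fiberCard a (Submodule.torsion O (Coker c J)) = mult c J a := by
    obtain ⟨e⟩ := (isInvariantFactors_invFactor c J hO).2.2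
    rw [fiberCard_congr a e, fiberCard_pi]
    simp only [fiberCard_quotient]
    rfl
  rw [hT, fiberCard,
    ← Nat.card_congr (lTensor.equiv (O ⧸ a) hex (Submodule.mkQ_surjective _)).toEquiv] at hC
  rw [Submodule.card_eq_card_quotient_mul_card (LinearMap.range f), hC] at hW
  rw [← Nat.card_congr e]
  have hN : 0 < idealNorm a := Nat.card_pos
  have h1 := finrank_coker_add_rk c J
  have h2 := rk_le c J
  have := finite_fiber a (M := (J → O))
  have hR : 0 < Nat.card (LinearMap.range f) := Nat.card_pos
  rw [← h1, pow_add] at hW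
  have hℓ : idealNorm a ^ ℓ = idealNorm a ^ (ℓ - rk c J) * idealNorm a ^ rk c J := by
    rw [← pow_add, Nat.sub_add_cancel h2]
  have hW' : Nat.card (LinearMap.range f) * mult c J a = idealNorm a ^ rk c J := by
    apply Nat.eq_of_mul_eq_mul_left (pow_pos hN (Module.finrank O (Coker c J)))
    rw [← hW]; ring
  apply Nat.eq_of_mul_eq_mul_left hR
  rw [mul_comm, hV, hℓ, ← hW']
  ring

theorem charQuasi_eq (hO : ¬ IsField O) {a : Ideal O} (ha : a ≠ ⊥) :
    charQuasi c a = ∑ J : Finset (Fin n),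
      (-1) ^ J.card * (mult c J a : ℤ) * (idealNorm a : ℤ) ^ (ℓ - rk c J) := by
  classical
  have := Ring.HasFiniteQuotients.finiteQuotient ha
  have := Fintype.ofFinite (O ⧸ a)
  have h := Finset.inclusion_exclusion_card_inf_compl Finset.univ
    fun j : Fin n => (solutions c {j} a).toFinset
  have hmem : ∀ j (y : Fin ℓ → O ⧸ a), y ∈ reducedHyperplane c a j ↔ y ∈ solutions c {j} a := by
    intro j y
    simp only [reducedHyperplane, solutions, Finset.mem_singleton, forall_eq, Set.mem_ofPred_eq]
    constructor
    · rintro ⟨x, rfl, hx⟩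
      simpa using Ideal.Quotient.eq_zero_iff_mem.2 hx
    · intro hy
      choose x hx using fun i => Ideal.Quotient.mk_surjective (y i)
      refine ⟨x, funext hx, Ideal.Quotient.eq_zero_iff_mem.1 ?_⟩
      simpa [hx] using hy
  have hL : charQuasi c a =
      ((Finset.univ.inf fun j : Fin n => (solutions c {j} a).toFinsetᶜ).card : ℤ) := by
    rw [charQuasi, Nat.card_coe_set_eq, Set.ncard_eq_toFinset_card']
    congr 2
    ext y
    rw [Set.mem_toFinset]
    simp [complement, hmem, Finset.mem_inf]
  rw [hL, h, Finset.powerset_univ]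
  refine Finset.sum_congr rfl fun J _ => ?_
  have hJ : (J.inf fun j => (solutions c {j} a).toFinset) = (solutions c J a).toFinset := by
    ext y
    simp only [Finset.mem_inf, Set.mem_toFinset]
    simp [solutions]
  rw [hJ, ← Set.ncard_eq_toFinset_card', ← Nat.card_coe_set_eq, card_solutions c J hO ha]
  push_cast
  ring

theorem lcmPeriod_le_invFactor (hO : ¬ IsField O) (i : Fin (rk c J)) :
    lcmPeriod c ≤ invFactor c J i := by
  have hpos : 0 < rk c J := i.pos
  have hJ : J.Nonempty := by
    rw [Finset.nonempty_iff_ne_empty]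
    rintro rfl
    have := finrank_coker_add_rk c ∅
    simp at this
    omega
  refine (iInf₂_le J hJ).trans ((iInf_le _ hpos).trans (Ideal.dvd_iff_le.1 ?_))
  exact (isInvariantFactors_invFactor c J hO).2.1 _ _ (Fin.le_def.2 (Nat.le_sub_one_of_lt i.2))

theorem isConstituent_constituent (hO : ¬ IsField O) (κ : Ideal O) :
    IsConstituent (charQuasi c) (lcmPeriod c) κ (constituent c κ) := by
  intro a ha hκ
  rw [charQuasi_eq c hO ha, constituent, Polynomial.eval_finsetSum]
  refine Finset.sum_congr rfl fun J _ => ?_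
  -- Since `ρ ⊆ d_{J,i}`, `κ + d_{J,i} = a + ρ + d_{J,i} = a + d_{J,i}`.
  have : mult c J κ = mult c J a := Finset.prod_congr rfl fun i _ => by
    rw [← hκ, sup_assoc, sup_eq_right.2 (lcmPeriod_le_invFactor c J hO i)]
  simp [this]

end Counting

/-- Finitely many ideals have norm at most `B`, so infinitely many `a` give infinitely many values
`N(a)` at which the two polynomials agree. -/
theorem eq_of_isConstituent {O : Type*} [CommRing O] [Ring.HasFiniteQuotients O]
    {φ : Ideal O → ℤ} {ρ κ : Ideal O}
    (h : {a : Ideal O | a ≠ ⊥ ∧ a ⊔ ρ = κ}.Infinite) {f g : Polynomial ℤ}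
    (hf : IsConstituent φ ρ κ f) (hg : IsConstituent φ ρ κ g) : f = g := by
  refine Polynomial.eq_of_infinite_eval_eq f g ?_
  have : ((fun a : Ideal O => (idealNorm a : ℤ)) '' {a | a ≠ ⊥ ∧ a ⊔ ρ = κ}).Infinite := by
    intro hfin
    obtain ⟨B, hB⟩ := hfin.bddAbove
    refine h ((Ring.HasFiniteQuotients.finite_cardQuot_le B.toNat).subset fun a ha => ?_)
    have h1 : (idealNorm a : ℤ) ≤ B := hB ⟨a, ha, rfl⟩
    change idealNorm a ≤ B.toNat
    omega
  refine this.mono ?_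
  rintro _ ⟨a, ⟨ha, hκ⟩, rfl⟩
  exact (hf a ha hκ).symm.trans (hg a ha hκ)

/-! ### The poset of layers and its Möbius function -/

section Layers

variable {O : Type*} [CommRing O] (K : Type*) [Field K] [Algebra O K]
  {n ℓ : ℕ} (c : Fin n → Fin ℓ → O)

/-- The linear form `x ↦ x c_j` on `K ^ ℓ`. -/
noncomputable abbrev pairing (j : Fin n) : (Fin ℓ → K) →ₗ[K] K :=
  Fintype.linearCombination K fun i => algebraMap O K (c j i)

variable {K c}

theorem pairing_apply (j : Fin n) (x : Fin ℓ → K) :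
    pairing K c j x = ∑ i, x i * algebraMap O K (c j i) := rfl

theorem pairing_algebraMap (j : Fin n) (a : Fin ℓ → O) :
    pairing K c j (fun i => algebraMap O K (a i)) = algebraMap O K (∑ i, a i * c j i) := by
  simp [pairing_apply]

theorem pairing_smul (j : Fin n) (b : O) (x : Fin ℓ → K) :
    pairing K c j (b • x) = algebraMap O K b * pairing K c j x := by
  rw [← algebraMap_smul K b x, map_smul, smul_eq_mul]

theorem mem_flat_iff_pairing {J : Finset (Fin n)} {x : Fin ℓ → K} :
    x ∈ flat K c J ↔ ∀ j ∈ J, pairing K c j x = 0 := mem_flat K c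

theorem exists_of_proj_eq {x x' : Fin ℓ → K} (h : proj O K ℓ x = proj O K ℓ x') :
    ∃ a : Fin ℓ → O, x = x' + fun i => algebraMap O K (a i) := by
  have : ∀ i, ∃ a, algebraMap O K a = x i - x' i := fun i =>
    (Submodule.Quotient.eq _).1 (congrFun h i)
  choose a ha using this
  exact ⟨a, funext fun i => by simp [ha]⟩

theorem proj_mem_torus_iff {j : Fin n} {x : Fin ℓ → K} :
    proj O K ℓ x ∈ torus K c j ↔ ∃ y : O, pairing K c j x = algebraMap O K y := by
  constructor
  · rintro ⟨x', hx', b, hb⟩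
    obtain ⟨a, rfl⟩ := exists_of_proj_eq hx'.symm
    refine ⟨b + ∑ i, a i * c j i, ?_⟩
    rw [map_add, pairing_algebraMap, map_add, hb, pairing_apply]
  · rintro ⟨y, hy⟩
    exact ⟨x, rfl, y, hy.symm⟩

/-- If `t ≠ 0` then `K t = K`, and `O` would be the field `K`. This is what lets a subspace of `K ^
ℓ` be tested on its image in `(K / O) ^ ℓ`. -/
theorem eq_zero_of_forall_mul_mem [IsDomain O] [IsFractionRing O K] (hO : ¬ IsField O) {t : K}
    (h : ∀ s : K, ∃ y : O, s * t = algebraMap O K y) : t = 0 := by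
  by_contra ht
  have hs : Function.Surjective (algebraMap O K) := fun k => by
    obtain ⟨y, hy⟩ := h (k * t⁻¹)
    exact ⟨y, by rw [← hy, mul_assoc, inv_mul_cancel₀ ht, mul_one]⟩
  exact hO ((RingEquiv.ofBijective (algebraMap O K)
    ⟨IsFractionRing.injective O K, hs⟩).toMulEquiv.isField (Field.toIsField K))

/-- If the image of a subspace in `(K / O) ^ ℓ` lies in `T_J`, the subspace lies in `H_J`. -/
theorem le_flat_of_forall_mem [IsDomain O] [IsFractionRing O K] (hO : ¬ IsField O)
    {H : Submodule K (Fin ℓ → K)} {J : Finset (Fin n)}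
    (h : ∀ x ∈ H, ∀ j ∈ J, ∃ y : O, pairing K c j x = algebraMap O K y) : H ≤ flat K c J := by
  intro x hx
  rw [mem_flat_iff_pairing]
  intro j hj
  refine eq_zero_of_forall_mul_mem hO fun s => ?_
  rw [← smul_eq_mul, ← map_smul]
  exact h _ (H.smul_mem s hx) j hj

theorem proj_mem_torusInter_iff {J : Finset (Fin n)} {x : Fin ℓ → K} :
    proj O K ℓ x ∈ torusInter K c J ↔ ∀ j ∈ J, ∃ y : O, pairing K c j x = algebraMap O K y := by
  simp [torusInter, proj_mem_torus_iff]

theorem coset_subset_torusInter_iff [IsDomain O] [IsFractionRing O K] (hO : ¬ IsField O)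
    {z : Fin ℓ → KmodO O K} {H : Submodule K (Fin ℓ → K)} {J : Finset (Fin n)} :
    coset O z H ⊆ torusInter K c J ↔ z ∈ torusInter K c J ∧ H ≤ flat K c J := by
  obtain ⟨x, rfl⟩ := proj_surjective K z
  constructor
  · intro h
    have hx := h (mem_coset_self _ H)
    refine ⟨hx, le_flat_of_forall_mem hO fun w hw j hj => ?_⟩
    have h1 := h ⟨w, hw, rfl⟩
    rw [← map_add, proj_mem_torusInter_iff] at h1
    rw [proj_mem_torusInter_iff] at hx
    obtain ⟨y, hy⟩ := hx j hj
    obtain ⟨y', hy'⟩ := h1 j hj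
    exact ⟨y' - y, by rw [map_sub, ← hy, ← hy', map_add]; ring⟩
  · rintro ⟨hx, hH⟩ _ ⟨w, hw, rfl⟩
    rw [← map_add, proj_mem_torusInter_iff]
    intro j hj
    rw [map_add, mem_flat_iff_pairing.1 (hH hw) j hj, add_zero]
    exact proj_mem_torusInter_iff.1 hx j hj

theorem coset_subset_coset_iff [IsDomain O] [IsFractionRing O K] (hO : ¬ IsField O)
    {z w : Fin ℓ → KmodO O K} {H : Submodule K (Fin ℓ → K)} {J : Finset (Fin n)} :
    coset O z H ⊆ coset O w (flat K c J) ↔ z ∈ coset O w (flat K c J) ∧ H ≤ flat K c J := by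
  constructor
  · intro h
    have hz := h (mem_coset_self z H)
    refine ⟨hz, le_flat_of_forall_mem hO fun x hx j hj => ?_⟩
    rw [coset_eq_of_mem hz] at h
    obtain ⟨v, hv, hv'⟩ := h ⟨x, hx, rfl⟩
    obtain ⟨a, rfl⟩ := exists_of_proj_eq (add_left_cancel hv')
    exact ⟨_, by rw [map_add, mem_flat_iff_pairing.1 hv j hj, zero_add, pairing_algebraMap]⟩
  · rintro ⟨hz, hH⟩ _ ⟨x, hx, rfl⟩
    rw [coset_eq_of_mem hz]
    exact ⟨x, hH hx, rfl⟩

/-- `Z` is a connected component of `T_J`. -/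
def Layer.IsComponent (Z : Layer K c) (J : Finset (Fin n)) : Prop :=
  ∃ z ∈ torusInter K c J, Z.1 = coset O z (TorsionArrangement.flat K c J)

theorem Layer.exists_isComponent (Z : Layer K c) : ∃ J, Z.IsComponent J := Z.2

section

variable [IsDomain O] [IsFractionRing O K] (hO : ¬ IsField O)

include hO

/-- Independence of the choice made in `Layer.flat`: inclusions of cosets force inclusions of their
subspaces. -/
theorem Layer.flat_eq {Z : Layer K c} {z : Fin ℓ → KmodO O K} {J : Finset (Fin n)}
    (h : Z.1 = coset O z (TorsionArrangement.flat K c J)) :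
    Z.flat = TorsionArrangement.flat K c J := by
  obtain ⟨⟨J', hJ'⟩, hZ⟩ : (∃ J, Z.flat = TorsionArrangement.flat K c J) ∧
    ∀ z ∈ Z.1, Z.1 = coset O z Z.flat := Z.exists_flat.choose_spec
  have hz : Z.1 = coset O z Z.flat := hZ z (h ▸ mem_coset_self z _)
  apply le_antisymm
  · exact ((coset_subset_coset_iff hO).1 (hz.symm.trans h).subset).2
  · rw [hJ'] at hz ⊢
    exact ((coset_subset_coset_iff hO).1 (h.symm.trans hz).subset).2

theorem Layer.subset_torusInter_iff (Z : Layer K c) (J : Finset (Fin n)) :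
    Z.1 ⊆ torusInter K c J ↔ ∃ Y : Layer K c, Y.IsComponent J ∧ Y ≤ Z := by
  constructor
  · intro h
    obtain ⟨J', z, hz, hZ⟩ := Z.2
    have h' := h
    rw [hZ, coset_subset_torusInter_iff hO] at h'
    refine ⟨⟨coset O z (TorsionArrangement.flat K c J), J, z, h'.1, rfl⟩, ⟨z, h'.1, rfl⟩, ?_⟩
    change Z.1 ⊆ coset O z _
    rw [hZ, coset_subset_coset_iff hO]
    exact ⟨mem_coset_self _ _, h'.2⟩
  · rintro ⟨Y, ⟨z, hz, hY⟩, hYZ⟩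
    have hYZ : Z.1 ⊆ Y.1 := hYZ
    refine hYZ.trans ?_
    rw [hY, coset_subset_torusInter_iff hO]
    exact ⟨hz, le_rfl⟩

omit hO [IsDomain O] [IsFractionRing O K] in
theorem Layer.nonempty (Z : Layer K c) : Z.1.Nonempty := by
  obtain ⟨J, z, hz, hZ⟩ := Z.2
  exact ⟨z, hZ ▸ mem_coset_self _ _⟩

omit hO [IsDomain O] [IsFractionRing O K] in
theorem Layer.IsComponent.eq_of_le {Y Y' Z : Layer K c} {J : Finset (Fin n)}
    (hY : Y.IsComponent J) (hY' : Y'.IsComponent J) (h : Y ≤ Z) (h' : Y' ≤ Z) : Y = Y' := by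
  obtain ⟨z, hz⟩ := Z.nonempty
  obtain ⟨y, -, hy⟩ := hY
  obtain ⟨y', -, hy'⟩ := hY'
  have h1 : z ∈ Y.1 := h hz
  have h2 : z ∈ Y'.1 := h' hz
  refine Subtype.ext ?_
  rw [hy] at h1 ⊢
  rw [hy'] at h2 ⊢
  rw [coset_eq_of_mem h1, coset_eq_of_mem h2]

theorem Layer.eq_ambient_iff (hc : ∀ j, c j ≠ 0) (Z : Layer K c) :
    ambient K c = Z ↔ ∀ j, ¬ Z.1 ⊆ torusInter K c {j} := by
  constructor
  · rintro rfl j hj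
    apply hc j
    have h : coset O (0 : Fin ℓ → KmodO O K) (⊤ : Submodule K (Fin ℓ → K)) ⊆ torusInter K c {j} :=
      fun x _ => hj (Set.mem_univ x)
    have h' := ((coset_subset_torusInter_iff hO).1 h).2
    funext i
    -- If all of `(K / O) ^ ℓ` lay in `T_j`, the form `x ↦ x c_j` would vanish on unit vectors, so
    -- `c j = 0`.
    have h1 := mem_flat_iff_pairing.1 (h' (Submodule.mem_top (x := Pi.single i 1))) j (by simp)
    rw [pairing_apply] at h1
    simpa [Pi.single_apply] using h1
  · intro h
    obtain ⟨J, z, hz, hZ⟩ := Z.2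
    rcases J.eq_empty_or_nonempty with rfl | ⟨j, hj⟩
    · refine Subtype.ext (Set.eq_univ_iff_forall.2 fun y => ?_).symm
      obtain ⟨x, hx⟩ := proj_surjective K (y - z)
      rw [hZ]
      exact ⟨x, by simp [TorsionArrangement.flat], by rw [hx]; abel⟩
    · refine absurd ?_ (h j)
      have hle : torusInter K c J ⊆ torusInter K c {j} := by
        intro x hx
        simp only [torusInter, Set.mem_iInter, Finset.mem_singleton] at hx ⊢
        intro k hk
        rw [hk]
        exact hx j hj
      refine Set.Subset.trans ?_ hle
      rw [hZ, coset_subset_torusInter_iff hO]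
      exact ⟨hz, le_rfl⟩

end

theorem ambient_le (Z : Layer K c) : ambient K c ≤ Z := Set.subset_univ Z.1

/-- A function whose sums over the intervals `[a, b]` are `δ_{a b}` is the Möbius function. -/
theorem eq_mu_of_sum_Icc {α : Type*} [PartialOrder α] [LocallyFiniteOrder α] [Finite α]
    [DecidableEq α] {a : α} {f : α → ℤ}
    (hf : ∀ b, a ≤ b → ∑ x ∈ Finset.Icc a b, f x = if a = b then 1 else 0) (b : α) (hab : a ≤ b) :
    f b = IncidenceAlgebra.mu ℤ a b := by
  induction b using WellFoundedLT.induction with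
  | ind b ih =>
    have h1 := hf b hab
    rw [← IncidenceAlgebra.sum_Icc_mu_right (𝕜 := ℤ), ← Finset.Ico_insert_right hab,
      Finset.sum_insert (by simp), Finset.sum_insert (by simp)] at h1
    have h2 : ∑ x ∈ Finset.Ico a b, f x = ∑ x ∈ Finset.Ico a b, IncidenceAlgebra.mu ℤ a x :=
      Finset.sum_congr rfl fun x hx => ih x (Finset.mem_Ico.1 hx).2 (Finset.mem_Ico.1 hx).1
    rw [h2] at h1
    exact add_right_cancel h1

open Classical in
-- Summed over `[T_∅, Z]`, the right side meets each `J` with `Z ⊆ T_J` once, since exactly one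
-- component of `T_J` contains `Z`. These `J` are the subsets of `S = {j | Z ⊆ T_j}`; their
-- alternating sum vanishes unless `S = ∅`, that is, `Z = T_∅`.
theorem mobius_ambient [IsDomain O] [Ring.HasFiniteQuotients O] [IsFractionRing O K]
    (hO : ¬ IsField O) (hc : ∀ j, c j ≠ 0) (Z : Layer K c) :
    mobius K c (ambient K c) Z =
      ∑ J : Finset (Fin n), if Z.IsComponent J then (-1 : ℤ) ^ J.card else 0 := by
  symm
  refine eq_mu_of_sum_Icc (f := fun Z : Layer K c =>
    ∑ J : Finset (Fin n), if Z.IsComponent J then (-1 : ℤ) ^ J.card else 0) ?_ Z (ambient_le Z)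
  intro Z _
  set S : Finset (Fin n) := {j | Z.1 ⊆ torusInter K c {j}} with hS
  have hmem : ∀ J, Z.1 ⊆ torusInter K c J ↔ J ∈ S.powerset := by
    intro J
    simp [hS, torusInter, Finset.subset_iff, Set.subset_iInter_iff]
  have h1 : ∀ J : Finset (Fin n), (∑ Y ∈ Finset.Icc (ambient K c) Z,
      if Y.IsComponent J then (-1 : ℤ) ^ J.card else 0) =
      if J ∈ S.powerset then (-1 : ℤ) ^ J.card else 0 := by
    intro J
    split_ifs with hJ
    · obtain ⟨Y, hY, hYZ⟩ := (Z.subset_torusInter_iff hO J).1 ((hmem J).2 hJ)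
      rw [Finset.sum_eq_single_of_mem Y (Finset.mem_Icc.2 ⟨ambient_le Y, hYZ⟩), if_pos hY]
      intro Y' hY' hne
      exact if_neg fun h => hne (h.eq_of_le hY (Finset.mem_Icc.1 hY').2 hYZ)
    · refine Finset.sum_eq_zero fun Y hY => if_neg fun h => hJ ?_
      exact (hmem J).1 ((Z.subset_torusInter_iff hO J).2 ⟨Y, h, (Finset.mem_Icc.1 hY).2⟩)
  rw [Finset.sum_comm, Finset.sum_congr rfl fun J _ => h1 J, Finset.sum_ite_mem,
    Finset.univ_inter, Finset.sum_powerset_neg_one_pow_card]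
  have : S = ∅ ↔ ambient K c = Z := by
    rw [Z.eq_ambient_iff hO hc]
    simp [hS, Finset.filter_eq_empty_iff]
  simp only [this]

end Layers

/-! ### Components of `T_J` and torsion of the cokernel -/

section Components

variable {O : Type*} [CommRing O] {K : Type*} [Field K] [Algebra O K]
  {n ℓ : ℕ} {c : Fin n → Fin ℓ → O}

/-- `x ∈ K ^ ℓ` has `x c_j ∈ O` for all `j ∈ J`, and `(x c_j)_{j ∈ J}` represents `t`. -/
def Represents {J : Finset (Fin n)} (x : Fin ℓ → K) (t : Coker c J) : Prop :=
  ∃ y : J → O, (∀ j : J, pairing K c j x = algebraMap O K (y j)) ∧ Submodule.Quotient.mk y = t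

variable {J : Finset (Fin n)} {x x' : Fin ℓ → K} {t t' : Coker c J}

theorem Represents.sub (h : Represents x t) (h' : Represents x' t') :
    Represents (x - x') (t - t') := by
  obtain ⟨y, hy, rfl⟩ := h
  obtain ⟨y', hy', rfl⟩ := h'
  exact ⟨y - y', fun j => by rw [map_sub, hy, hy', Pi.sub_apply, map_sub], rfl⟩

theorem Represents.smul (b : O) (h : Represents x t) : Represents (b • x) (b • t) := by
  obtain ⟨y, hy, rfl⟩ := h
  exact ⟨b • y, fun j => by rw [pairing_smul, hy, Pi.smul_apply, smul_eq_mul, map_mul], rfl⟩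

theorem phi_apply (a : Fin ℓ → O) (j : J) : phi c J a j = ∑ i, a i * c j i := rfl

theorem proj_mem_torusInter_iff_represents :
    proj O K ℓ x ∈ torusInter K c J ↔ ∃ t : Coker c J, Represents x t := by
  rw [proj_mem_torusInter_iff]
  constructor
  · intro h
    choose y hy using fun j : J => h j j.2
    exact ⟨_, y, hy, rfl⟩
  · rintro ⟨t, y, hy, -⟩ j hj
    exact ⟨_, hy ⟨j, hj⟩⟩

/-- The class is zero when the pairings of `x` are those of some `a ∈ O ^ ℓ`, that is, when `x - a ∈
H_J`. Hence a coset of `π(H_J)` determines a class and conversely. -/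
theorem represents_zero_iff :
    Represents x (0 : Coker c J) ↔ proj O K ℓ x ∈ proj O K ℓ '' (flat K c J : Set (Fin ℓ → K)) := by
  constructor
  · rintro ⟨y, hy, h⟩
    obtain ⟨a, rfl⟩ := (Submodule.Quotient.mk_eq_zero _).1 h
    refine ⟨x - fun i => algebraMap O K (a i), ?_, ?_⟩
    · rw [SetLike.mem_coe, mem_flat_iff_pairing]
      intro j hj
      rw [map_sub, pairing_algebraMap, hy ⟨j, hj⟩, phi_apply, sub_self]
    · rw [map_sub, proj_eq_zero K a fun _ => rfl, sub_zero]
  · rintro ⟨w, hw, h⟩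
    obtain ⟨a, rfl⟩ := exists_of_proj_eq h.symm
    refine ⟨phi c J a, fun j => ?_, (Submodule.Quotient.mk_eq_zero _).2 ⟨a, rfl⟩⟩
    rw [map_add, mem_flat_iff_pairing.1 hw j j.2, zero_add, pairing_algebraMap, phi_apply]

theorem coset_proj_eq_iff :
    coset O (proj O K ℓ x) (flat K c J) = coset O (proj O K ℓ x') (flat K c J) ↔
      Represents (x - x') (0 : Coker c J) := by
  rw [represents_zero_iff]
  constructor
  · intro h
    obtain ⟨w, hw, hx⟩ : proj O K ℓ x ∈ coset O (proj O K ℓ x') (flat K c J) :=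
      h ▸ mem_coset_self _ _
    exact ⟨w, hw, by rw [map_sub, hx, add_sub_cancel_left]⟩
  · rintro ⟨w, hw, hx⟩
    refine (coset_eq_of_mem ⟨w, hw, ?_⟩).symm
    rw [hx, map_sub, add_sub_cancel]

section

variable [IsDomain O] [IsFractionRing O K]

omit [IsDomain O] in
theorem Represents.unique (h : Represents x t) (h' : Represents x t') : t = t' := by
  obtain ⟨y, hy, rfl⟩ := h
  obtain ⟨y', hy', rfl⟩ := h'
  congr 1
  exact funext fun j => IsFractionRing.injective O K ((hy j).symm.trans (hy' j))

omit [IsDomain O] in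
-- A common denominator of the coordinates of `x` kills the class.
theorem Represents.mem_torsion (h : Represents x t) : t ∈ Submodule.torsion O (Coker c J) := by
  obtain ⟨b, hb⟩ := IsLocalization.exist_integer_multiples_of_finite (nonZeroDivisors O) x
  choose a ha using hb
  refine ⟨b, (h.smul (b : O)).unique (represents_zero_iff.2 ⟨0, Submodule.zero_mem _, ?_⟩)⟩
  rw [map_zero, proj_eq_zero K (x := (b : O) • x) a fun i => (ha i).symm]

theorem exists_represents (ht : t ∈ Submodule.torsion O (Coker c J)) :
    ∃ x : Fin ℓ → K, Represents x t := by
  obtain ⟨b, hb⟩ := ht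
  obtain ⟨y, rfl⟩ := Submodule.Quotient.mk_surjective _ t
  obtain ⟨a, ha⟩ := (Submodule.Quotient.mk_eq_zero _).1 hb
  have hb0 : algebraMap O K b ≠ 0 := IsFractionRing.to_map_ne_zero_of_mem_nonZeroDivisors b.2
  -- From `b y = φ_J(a)`, the vector `a / b` has pairings `y`.
  refine ⟨(algebraMap O K b)⁻¹ • fun i => algebraMap O K (a i), y, fun j => ?_, rfl⟩
  have h := congrFun ha j
  rw [phi_apply] at h
  rw [map_smul, pairing_algebraMap, h]
  change _ • algebraMap O K ((b : O) * y j) = _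
  rw [map_mul, smul_eq_mul, inv_mul_cancel_left₀ hb0]

theorem Layer.isTorsion_iff (hO : ¬ IsField O) {Z : Layer K c}
    (hZ : Z.1 = coset O (proj O K ℓ x) (TorsionArrangement.flat K c J)) (ht : Represents x t)
    (κ : Ideal O) : Z.IsTorsion κ ↔ ∀ b ∈ κ, b • t = 0 := by
  have key : ∀ b : O, b • t = 0 ↔
      b • proj O K ℓ x ∈ proj O K ℓ '' (TorsionArrangement.flat K c J : Set (Fin ℓ → K)) := by
    intro b
    rw [← map_smul, ← represents_zero_iff]
    exact ⟨fun h => h ▸ ht.smul b, fun h => (ht.smul b).unique h⟩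
  simp only [Layer.IsTorsion, Layer.flat_eq hO hZ, key]
  refine forall₂_congr fun b _ => ⟨fun h => h _ (hZ ▸ mem_coset_self _ _), fun h z hz => ?_⟩
  rw [hZ] at hz
  obtain ⟨w, hw, rfl⟩ := hz
  obtain ⟨v, hv, hv'⟩ := h
  have hbw : b • w ∈ TorsionArrangement.flat K c J := by
    rw [← algebraMap_smul K b w]
    exact Submodule.smul_mem _ _ hw
  exact ⟨v + b • w, Submodule.add_mem _ hv hbw, by rw [map_add, hv', map_smul, smul_add]⟩

omit [IsDomain O] [IsFractionRing O K] in
theorem Layer.IsComponent.exists_represents {Z : Layer K c} (h : Z.IsComponent J) :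
    ∃ (x : Fin ℓ → K) (t : Coker c J), Represents x t ∧
      Z.1 = coset O (proj O K ℓ x) (TorsionArrangement.flat K c J) := by
  obtain ⟨z, hz, hZ⟩ := h
  obtain ⟨x, rfl⟩ := proj_surjective K z
  obtain ⟨t, ht⟩ := proj_mem_torusInter_iff_represents.1 hz
  exact ⟨x, t, ht, hZ⟩

/-- The `κ`-torsion components of `T_J` correspond to the `κ`-torsion of the torsion submodule of
the cokernel of `φ_J`. -/
theorem card_isComponent_isTorsion (hO : ¬ IsField O) (κ : Ideal O) :
    Nat.card {Z : Layer K c // Z.IsComponent J ∧ Z.IsTorsion κ} =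
      Nat.card {t : Submodule.torsion O (Coker c J) // ∀ b ∈ κ, b • t = 0} := by
  choose x hx using fun t : Submodule.torsion O (Coker c J) => exists_represents (K := K) t.2
  have hmem : ∀ t, proj O K ℓ (x t) ∈ torusInter K c J := fun t =>
    proj_mem_torusInter_iff_represents.2 ⟨_, hx t⟩
  let L (t : Submodule.torsion O (Coker c J)) : Layer K c :=
    ⟨coset O (proj O K ℓ (x t)) (flat K c J), J, _, hmem t, rfl⟩
  have htors : ∀ t, (L t).IsTorsion κ ↔ ∀ b ∈ κ, b • t = 0 := fun t => by
    rw [Layer.isTorsion_iff hO rfl (hx t)]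
    exact forall₂_congr fun b _ => by rw [← Subtype.coe_inj]; rfl
  symm
  refine Nat.card_congr (Equiv.ofBijective
    (fun t => ⟨L t.1, ⟨_, hmem t.1, rfl⟩, (htors t.1).2 t.2⟩) ⟨?_, ?_⟩)
  · rintro ⟨t, ht⟩ ⟨t', ht'⟩ h
    have h1 := congrArg (fun Z => Z.1.1) h
    have h2 := (coset_proj_eq_iff.1 h1).unique ((hx t).sub (hx t'))
    exact Subtype.ext (Subtype.ext (sub_eq_zero.1 h2.symm))
  · rintro ⟨Z, hZ, hκ⟩
    obtain ⟨x', t, ht, hZ'⟩ := hZ.exists_represents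
    have hL : L ⟨t, ht.mem_torsion⟩ = Z := Subtype.ext <| by
      rw [hZ']
      refine coset_proj_eq_iff.2 ?_
      have := (hx ⟨t, ht.mem_torsion⟩).sub ht
      rwa [sub_self] at this
    exact ⟨⟨⟨t, ht.mem_torsion⟩, (htors _).1 (hL ▸ hκ)⟩, Subtype.ext hL⟩

/-- `H_J` is the kernel of `φ_J` extended to `K`, whose image is the localization of the image of
`φ_J` and so has dimension `r(J)`. -/
theorem finrank_flat (J : Finset (Fin n)) :
    Module.finrank K (flat K c J) = ℓ - rk c J := by
  set Φ : (Fin ℓ → K) →ₗ[K] (J → K) := LinearMap.pi fun j => pairing K c j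
  set f : (J → O) →ₗ[O] (J → K) := (Algebra.linearMap O K).compLeft J
  have hker : flat K c J = LinearMap.ker Φ := by
    ext x
    rw [mem_flat_iff_pairing, LinearMap.mem_ker, funext_iff]
    simp [Φ]
  have : IsLocalizedModule (nonZeroDivisors O) f := by
    exact IsLocalizedModule.pi (nonZeroDivisors O) fun _ => Algebra.linearMap O K
  have hrange : LinearMap.range Φ =
      (LinearMap.range (phi c J)).localized' K (nonZeroDivisors O) f := by
    ext z
    rw [Submodule.mem_localized']
    constructor
    · rintro ⟨x, rfl⟩
      obtain ⟨b, hb⟩ := IsLocalization.exist_integer_multiples_of_finite (nonZeroDivisors O) x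
      choose a ha using hb
      refine ⟨phi c J a, ⟨a, rfl⟩, b, ?_⟩
      rw [IsLocalizedModule.mk'_eq_iff]
      funext j
      change algebraMap O K (phi c J a j) = (b : O) • pairing K c j x
      rw [phi_apply, ← pairing_algebraMap, ← LinearMap.map_smul_of_tower]
      congr 1
      exact funext ha
    · rintro ⟨_, ⟨a, rfl⟩, b, rfl⟩
      have hb0 : algebraMap O K b ≠ 0 := IsFractionRing.to_map_ne_zero_of_mem_nonZeroDivisors b.2
      refine ⟨(algebraMap O K b)⁻¹ • fun i => algebraMap O K (a i), ?_⟩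
      symm
      rw [IsLocalizedModule.mk'_eq_iff]
      funext j
      change algebraMap O K (phi c J a j) = (b : O) • pairing K c j _
      rw [map_smul, pairing_algebraMap, phi_apply, Algebra.smul_def, smul_eq_mul,
        mul_inv_cancel_left₀ hb0]
  have h1 := Φ.finrank_range_add_finrank_ker
  have h2 : Module.finrank K (LinearMap.range Φ) = rk c J := by
    rw [hrange, rk]
    rw [IsFractionRing.finrank_right_eq O K]
    exact IsLocalizedModule.finrank_eq (nonZeroDivisors O)
      ((LinearMap.range (phi c J)).toLocalized' K (nonZeroDivisors O) f) le_rfl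
  rw [h2, ← hker] at h1
  simp only [Module.finrank_fintype_fun_eq_card, Fintype.card_fin] at h1
  omega

theorem Layer.IsComponent.dim_eq (hO : ¬ IsField O) {Z : Layer K c} (h : Z.IsComponent J) :
    Z.dim = ℓ - rk c J := by
  obtain ⟨z, -, hZ⟩ := h
  rw [Layer.dim, Layer.flat_eq hO hZ, finrank_flat]

end

variable [IsDedekindDomain O] [Ring.HasFiniteQuotients O] [IsFractionRing O K]

theorem card_torsion_coker (hO : ¬ IsField O) (J : Finset (Fin n)) (κ : Ideal O) :
    Nat.card {t : Submodule.torsion O (Coker c J) // ∀ b ∈ κ, b • t = 0} = mult c J κ := by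
  have := infinite_of_not_isField hO
  obtain ⟨h0, -, ⟨e⟩⟩ := isInvariantFactors_invFactor c J hO
  have e1 : {t : Submodule.torsion O (Coker c J) // ∀ b ∈ κ, b • t = 0} ≃
      {t : ∀ i, O ⧸ invFactor c J i // ∀ i, ∀ b ∈ κ, b • t i = 0} :=
    e.toEquiv.subtypeEquiv fun t => by
      rw [forall_comm]
      refine forall_congr' fun b => ?_
      rw [forall_comm]
      refine forall_congr' fun _ => ?_
      rw [← e.map_eq_zero_iff, map_smul, funext_iff]
      rfl
  rw [Nat.card_congr (e1.trans (Equiv.subtypePiEquivPi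
    (p := fun i (y : O ⧸ invFactor c J i) => ∀ b ∈ κ, b • y = 0))), Nat.card_pi]
  exact Finset.prod_congr rfl fun i _ => card_torsion_quotient κ (h0 i)

/-- `ρ` lies in every `d_{J,i}`, so it kills the torsion of every cokernel. -/
theorem Layer.isTorsion_lcmPeriod (hO : ¬ IsField O) (Z : Layer K c) :
    Z.IsTorsion (lcmPeriod c) := by
  obtain ⟨J, hJ⟩ := Z.exists_isComponent
  obtain ⟨x, t, ht, hZ⟩ := hJ.exists_represents
  rw [Layer.isTorsion_iff hO hZ ht]
  intro b hb
  obtain ⟨e⟩ := (isInvariantFactors_invFactor c J hO).2.2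
  have h : b • (⟨t, ht.mem_torsion⟩ : Submodule.torsion O (Coker c J)) = 0 := by
    rw [← e.map_eq_zero_iff, map_smul]
    funext i
    obtain ⟨y, hy⟩ := Ideal.Quotient.mk_surjective (e ⟨t, ht.mem_torsion⟩ i)
    rw [Pi.smul_apply, ← hy]
    exact Ideal.Quotient.eq_zero_iff_mem.2
      (Ideal.mul_mem_right _ _ (lcmPeriod_le_invFactor c J hO i hb))
  exact congrArg Subtype.val h

theorem torsionCharPoly_lcmPeriod (hO : ¬ IsField O) :
    torsionCharPoly K c (lcmPeriod c) = charPoly K c := by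
  have : {Z : Layer K c | Z.IsTorsion (lcmPeriod c)} = Set.univ :=
    Set.eq_univ_iff_forall.2 fun Z => Z.isTorsion_lcmPeriod hO
  simp only [torsionCharPoly, charPoly, torsionLayers, this]

/-- Both sides are sums over pairs of a set `J` and a `κ`-torsion component of `T_J`; each such
component has dimension `ℓ - r(J)`. -/
theorem constituent_eq_torsionCharPoly (hO : ¬ IsField O) (hc : ∀ j, c j ≠ 0) (κ : Ideal O) :
    constituent c κ = torsionCharPoly K c κ := by
  classical
  have hm : ∀ J : Finset (Fin n), (mult c J κ : ℤ) =
      ∑ Z ∈ torsionLayers K c κ, if Z.IsComponent J then 1 else 0 := by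
    intro J
    rw [← card_torsion_coker hO, ← card_isComponent_isTorsion (K := K) hO, Finset.sum_boole,
      ← Nat.subtype_card]
    intro Z
    simp [torsionLayers, and_comm]
  have hs : ∀ (Z : Layer K c) (J : Finset (Fin n)),
      Polynomial.C ((-1 : ℤ) ^ J.card * if Z.IsComponent J then 1 else 0) *
        Polynomial.X ^ (ℓ - rk c J) =
      Polynomial.C (if Z.IsComponent J then (-1 : ℤ) ^ J.card else 0) * Polynomial.X ^ Z.dim := by
    intro Z J
    split_ifs with h
    · rw [h.dim_eq hO, mul_one]
    · simp
  simp only [constituent, torsionCharPoly, hm, mobius_ambient hO hc, Finset.mul_sum, map_sum,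
    Finset.sum_mul, hs]
  exact Finset.sum_comm

end Components

end TorsionArrangement

open TorsionArrangement in
theorem mainTheorem2 {O : Type*} [CommRing O] [IsDedekindDomain O] [Ring.HasFiniteQuotients O]
    (hO : ¬ IsField O) (K : Type*) [Field K] [Algebra O K] [IsFractionRing O K]
    {n ℓ : ℕ} (c : Fin n → Fin ℓ → O) (hc : ∀ j, c j ≠ 0) :
    (∀ J : Finset (Fin n), IsInvariantFactors c J (invFactor c J)) ∧
    (∀ κ : Ideal O, κ ∣ lcmPeriod c →
      constituent c κ = torsionCharPoly K c κ ∧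
      IsConstituent (charQuasi c) (lcmPeriod c) κ (torsionCharPoly K c κ) ∧
      ({a : Ideal O | a ≠ ⊥ ∧ a ⊔ lcmPeriod c = κ}.Infinite →
        ∀ g : Polynomial ℤ, IsConstituent (charQuasi c) (lcmPeriod c) κ g →
          g = torsionCharPoly K c κ)) ∧
    torsionCharPoly K c (lcmPeriod c) = charPoly K c := by
  refine ⟨fun J => isInvariantFactors_invFactor c J hO, fun κ _ => ?_,
    torsionCharPoly_lcmPeriod hO⟩
  have h := constituent_eq_torsionCharPoly (K := K) hO hc κ
  have hκ := h ▸ isConstituent_constituent c hO κ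
  exact ⟨h, hκ, fun hinf g hg => eq_of_isConstituent hinf hg hκ⟩
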